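/- Let $R$ be a commutative ring and $S\subset R$ a multiplicative subset (with $1\in S$) such that the $R$-module $S^{-1}R$ has projective dimension at most $1$ and the $S$-torsion in $R$ is bounded, i.e. there is $r\in S$ such that $rx=0$ for every $x\in R$ annihilated by some element of $S$. Let $R\text{-mod}_{S\text{-tors}}\subset R\text{-mod}$ be the full subcategory of $S$-torsion modules (modules $M$ in which every element is annihilated by some $s\in S$), and let $R\text{-mod}_{S\text{-ctra}}\subset R\text{-mod}$ be the full subcategory of $S$-contramodules (modules $C$ with $\mathrm{Ext}^n_R(S^{-1}R,C)=0$ for $n=0,1$). Under these assumptions both are abelian categories with exact embeddings into $R\text{-mod}$. Then for every conventional derived category symbol $\star=b$, $+$, $-$ or $\varnothing$ there is a natural triangulated equivalence $$E\colon D^\star(R\text{-mod}_{S\text{-tors}})\;\simeq\; D^\star(R\text{-mod}_{S\text{-ctra}})$$ between the derived categories of these abelian categories. Here "natural" means that $E$ is compatible with the functors from both sides to the Verdier quotient $D^\star(R\text{-mod})/D^\star(S^{-1}R\text{-mod})$, in the following form: writing $\iota_t,\iota_c$ for the triangulated functors from $D^\star(R\text{-mod}_{S\text{-tors}})$ and $D^\star(R\text{-mod}_{S\text{-ctra}})$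 to $D^\star(R\text{-mod})$ induced by the exact embeddings, there is a natural transformation $\tau\colon\iota_t\to\iota_c\circ E$, compatible with the shifts, such that for every object $M$ the cone of $\tau_M\colon\iota_t(M)\to\iota_c(E(M))$ lies in the essential image of the restriction-of-scalars functor $D^\star(S^{-1}R\text{-mod})\to D^\star(R\text{-mod})$. -/

import Mathlib

open CategoryTheory Limits Pretriangulated Triangulated

universe w w₁ w₂ w₃ w₄ v v₁ v₂ u u₁ u₂

noncomputable section

namespace TriangulatedMatlis

/-! ### `S`-torsion modules and `S`-contramodules -/

section Modules

variable {R : Type u} [CommRing R] (S : Submonoid R)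

/-- The localization `S⁻¹R`, viewed as an `R`-module. -/
abbrev localizationModule : ModuleCat.{u} R := ModuleCat.of R (Localization S)

/-- An `R`-module `M` is `S`-torsion if every element of `M` is annihilated by some element
of `S`. -/
def isSTorsion : ObjectProperty (ModuleCat.{u} R) :=
  fun M => ∀ x : M, ∃ s ∈ S, s • x = 0

/-- An `R`-module `C` is an `S`-contramodule if `Ext^n_R(S⁻¹R, C) = 0` for `n = 0` and `n = 1`. -/
def isSContramodule : ObjectProperty (ModuleCat.{u} R) :=
  fun C => Subsingleton (Abelian.Ext (localizationModule S) C 0) ∧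
    Subsingleton (Abelian.Ext (localizationModule S) C 1)

/-- The `S`-torsion in `R` is bounded: some element of `S` annihilates all `S`-torsion elements
of the `R`-module `R`. -/
def HasBoundedTorsion : Prop :=
  ∃ r ∈ S, ∀ x : R, (∃ s ∈ S, s * x = 0) → r * x = 0

/-- The category `R-mod_{S-tors}` of `S`-torsion `R`-modules. -/
abbrev STors := (isSTorsion S).FullSubcategory

/-- The category `R-mod_{S-ctra}` of `S`-contramodule `R`-modules. -/
abbrev SCtra := (isSContramodule S).FullSubcategory

instance : (isSTorsion S).IsSerreClass where
  exists_zero := ⟨ModuleCat.of R PUnit, ModuleCat.isZero_of_subsingleton _,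
    fun x => ⟨1, S.one_mem, Subsingleton.elim _ _⟩⟩
  prop_of_mono {X Y} f hf hY x := by
    obtain ⟨s, hs, h⟩ := hY (f x)
    refine ⟨s, hs, (ModuleCat.mono_iff_injective f).1 hf ?_⟩
    rw [map_smul, h, map_zero]
  prop_of_epi {X Y} f hf hX y := by
    obtain ⟨x, rfl⟩ := (ModuleCat.epi_iff_surjective f).1 hf y
    obtain ⟨s, hs, h⟩ := hX x
    exact ⟨s, hs, by rw [← map_smul, h, map_zero]⟩
  prop_X₂_of_shortExact {T} hT h₁ h₃ x := by
    obtain ⟨s, hs, h⟩ := h₃ (T.g x)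
    have hx : T.g (s • x) = 0 := by rw [map_smul, h]
    obtain ⟨y, hy⟩ := (ShortComplex.ShortExact.moduleCat_exact_iff_function_exact T).1
      hT.exact (s • x) |>.1 hx
    obtain ⟨t, ht, h'⟩ := h₁ y
    refine ⟨t * s, S.mul_mem ht hs, ?_⟩
    rw [mul_smul, ← hy]
    exact (map_smul T.f.hom t y).symm.trans (by rw [h', map_zero])

lemma subsingleton_ext_zero_of_mono {A : Type u} [Category.{v} A] [Abelian A]
    [HasExt.{w} A] (X : A) {Y Z : A} (f : Y ⟶ Z) [Mono f]
    (h : Subsingleton (Abelian.Ext X Z 0)) : Subsingleton (Abelian.Ext X Y 0) :=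
  (Abelian.Ext.postcomp_mk₀_injective_of_mono X f).subsingleton

lemma subsingleton_ext_X₂ {A : Type u} [Category.{v} A] [Abelian A]
    [HasExt.{w} A] (X : A) {T : ShortComplex A} (hT : T.ShortExact) (n : ℕ)
    (h₁ : Subsingleton (Abelian.Ext X T.X₁ n)) (h₃ : Subsingleton (Abelian.Ext X T.X₃ n)) :
    Subsingleton (Abelian.Ext X T.X₂ n) :=
  subsingleton_of_forall_eq 0 fun x => by
    obtain ⟨y, rfl⟩ := Abelian.Ext.covariant_sequence_exact₂ X hT x (Subsingleton.elim _ _)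
    rw [Subsingleton.elim y 0, Abelian.Ext.zero_comp]

lemma subsingleton_ext_X₃ {A : Type u} [Category.{v} A] [Abelian A]
    [HasExt.{w} A] (X : A) {T : ShortComplex A} (hT : T.ShortExact) (n : ℕ)
    (h₂ : Subsingleton (Abelian.Ext X T.X₂ n))
    (h₁ : Subsingleton (Abelian.Ext X T.X₁ (n + 1))) :
    Subsingleton (Abelian.Ext X T.X₃ n) :=
  subsingleton_of_forall_eq 0 fun x => by
    obtain ⟨y, rfl⟩ := Abelian.Ext.covariant_sequence_exact₃ X hT x rfl (Subsingleton.elim _ _)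
    rw [Subsingleton.elim y 0, Abelian.Ext.zero_comp]

lemma subsingleton_ext_X₁ {A : Type u} [Category.{v} A] [Abelian A]
    [HasExt.{w} A] (X : A) {T : ShortComplex A} (hT : T.ShortExact) (n : ℕ)
    (h₃ : Subsingleton (Abelian.Ext X T.X₃ n))
    (h₂ : Subsingleton (Abelian.Ext X T.X₂ (n + 1))) :
    Subsingleton (Abelian.Ext X T.X₁ (n + 1)) :=
  subsingleton_of_forall_eq 0 fun x => by
    obtain ⟨y, rfl⟩ := Abelian.Ext.covariant_sequence_exact₁ X hT x (Subsingleton.elim _ _) rfl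
    rw [Subsingleton.elim y 0, Abelian.Ext.zero_comp]

instance : (isSContramodule S).ContainsZero where
  exists_zero := by
    have h : IsZero (ModuleCat.of R PUnit.{u + 1}) := ModuleCat.isZero_of_subsingleton _
    refine ⟨_, h, subsingleton_of_forall_eq 0 fun x => ?_, subsingleton_of_forall_eq 0 fun x => ?_⟩
    all_goals
      rw [← Abelian.Ext.comp_mk₀_id x, h.eq_of_src (𝟙 _) 0, Abelian.Ext.mk₀_zero,
        Abelian.Ext.comp_zero]

instance : (isSContramodule S).IsClosedUnderExtensions where
  prop_X₂_of_shortExact hT h₁ h₃ :=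
    ⟨subsingleton_ext_X₂ _ hT 0 h₁.1 h₃.1, subsingleton_ext_X₂ _ hT 1 h₁.2 h₃.2⟩

instance : (isSContramodule S).IsClosedUnderIsomorphisms where
  of_iso {X Y} e h := by
    refine ⟨subsingleton_of_forall_eq 0 fun x => ?_, subsingleton_of_forall_eq 0 fun x => ?_⟩
    · have := h.1
      rw [← Abelian.Ext.comp_mk₀_id x, ← e.inv_hom_id, ← Abelian.Ext.mk₀_comp_mk₀,
        ← Abelian.Ext.comp_assoc_of_third_deg_zero,
        Subsingleton.elim (x.comp (Abelian.Ext.mk₀ e.inv) (add_zero 0)) 0, Abelian.Ext.zero_comp]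
    · have := h.2
      rw [← Abelian.Ext.comp_mk₀_id x, ← e.inv_hom_id, ← Abelian.Ext.mk₀_comp_mk₀,
        ← Abelian.Ext.comp_assoc_of_third_deg_zero,
        Subsingleton.elim (x.comp (Abelian.Ext.mk₀ e.inv) (add_zero 1)) 0, Abelian.Ext.zero_comp]

/-- The short exact sequence `0 → ker f → Y → im f → 0`, the image being written as the
coimage. -/
lemma shortExact_kernel_coimage {A : Type u} [Category.{v} A] [Abelian A]
    {Y Z : A} (f : Y ⟶ Z) :
    (ShortComplex.mk (kernel.ι f) (Abelian.coimage.π f)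
      (cokernel.condition _)).ShortExact where
  exact := ShortComplex.exact_of_g_is_cokernel _ (cokernelIsCokernel _)
  mono_f := by dsimp; infer_instance
  epi_g := by dsimp; infer_instance

/-- The short exact sequence `0 → im f → Z → coker f → 0`. -/
lemma shortExact_image_cokernel {A : Type u} [Category.{v} A] [Abelian A]
    {Y Z : A} (f : Y ⟶ Z) :
    (ShortComplex.mk (Abelian.image.ι f) (cokernel.π f)
      (kernel.condition _)).ShortExact where
  exact := ShortComplex.exact_of_f_is_kernel _ (kernelIsKernel _)
  mono_f := by dsimp; infer_instance
  epi_g := by dsimp; infer_instance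

lemma isSContramodule_kernel {Y Z : ModuleCat.{u} R} (f : Y ⟶ Z)
    (hY : isSContramodule S Y) (hZ : isSContramodule S Z) :
    isSContramodule S (kernel f) :=
  ⟨subsingleton_ext_zero_of_mono _ (kernel.ι f) hY.1,
    subsingleton_ext_X₁ _ (shortExact_kernel_coimage f) 0
      (subsingleton_ext_zero_of_mono _ (Abelian.factorThruCoimage f) hZ.1) hY.2⟩

instance : (isSContramodule S).IsClosedUnderKernels where
  kernels_le := by
    rintro _ ⟨f, k, hk, hf⟩
    exact (isSContramodule S).prop_of_iso
      ((kernelIsKernel f).conePointUniqueUpToIso hk) (isSContramodule_kernel S f hf.1 hf.2)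

lemma isSContramodule_cokernel [HasProjectiveDimensionLE (localizationModule S) 1]
    {Y Z : ModuleCat.{u} R} (f : Y ⟶ Z)
    (hY : isSContramodule S Y) (hZ : isSContramodule S Z) :
    isSContramodule S (cokernel f) := by
  have h₂ (M : ModuleCat.{u} R) : Subsingleton (Abelian.Ext (localizationModule S) M 2) :=
    HasProjectiveDimensionLT.subsingleton _ 2 2 le_rfl _
  have h₁ : Subsingleton (Abelian.Ext (localizationModule S) (Abelian.coimage f) 1) :=
    subsingleton_ext_X₃ _ (shortExact_kernel_coimage f) 1 hY.2 (h₂ _)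
  have hi : Subsingleton (Abelian.Ext (localizationModule S) (Abelian.image f) 1) :=
    subsingleton_of_forall_eq 0 fun x => by
      rw [← Abelian.Ext.comp_mk₀_id x, ← (Abelian.coimageIsoImage f).inv_hom_id,
        ← Abelian.Ext.mk₀_comp_mk₀, ← Abelian.Ext.comp_assoc_of_third_deg_zero,
        Subsingleton.elim (x.comp (Abelian.Ext.mk₀ (Abelian.coimageIsoImage f).inv)
          (add_zero 1)) 0, Abelian.Ext.zero_comp]
  exact ⟨subsingleton_ext_X₃ _ (shortExact_image_cokernel f) 0 hZ.1 hi,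
    subsingleton_ext_X₃ _ (shortExact_image_cokernel f) 1 hZ.2 (h₂ _)⟩

instance [HasProjectiveDimensionLE (localizationModule S) 1] :
    (isSContramodule S).IsClosedUnderCokernels where
  cokernels_le := by
    rintro _ ⟨f, k, hk, hf⟩
    exact (isSContramodule S).prop_of_iso
      ((cokernelIsCokernel f).coconePointUniqueUpToIso hk)
      (isSContramodule_cokernel S f hf.1 hf.2)

lemma isClosedUnderFiniteProducts_of_extensions {A : Type u} [Category.{v} A] [Abelian A]
    (P : ObjectProperty A) [P.ContainsZero] [P.IsClosedUnderIsomorphisms]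
    [P.IsClosedUnderExtensions] : P.IsClosedUnderFiniteProducts := by
  have : P.IsClosedUnderBinaryProducts :=
    { limitsOfShape_le := by
        rintro X ⟨p⟩
        refine P.prop_of_iso ?_
          (P.prop_biprod (p.prop_diag_obj (.mk .left)) (p.prop_diag_obj (.mk .right)))
        exact IsLimit.conePointUniqueUpToIso (BinaryBiproduct.isLimit _ _)
          ((IsLimit.postcomposeHomEquiv (diagramIsoPair p.diag) _).2 p.isLimit) }
  exact .mk'

instance : (isSTorsion S).IsClosedUnderFiniteProducts :=
  isClosedUnderFiniteProducts_of_extensions _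

instance : (isSContramodule S).IsClosedUnderFiniteProducts :=
  isClosedUnderFiniteProducts_of_extensions _

end Modules

/-- The embedding of a full subcategory closed under kernels is left exact. -/
instance {A : Type u} [Category.{v} A] [Abelian A] (P : ObjectProperty A) [P.ContainsZero]
    [P.IsClosedUnderKernels] [P.IsClosedUnderCokernels] [P.IsClosedUnderFiniteProducts] :
    PreservesFiniteLimits P.ι :=
  have := P.preservesKernels_ι
  Functor.preservesFiniteLimits_of_preservesKernels P.ι

/-- The embedding of a full subcategory closed under cokernels is right exact. -/
instance {A : Type u} [Category.{v} A] [Abelian A] (P : ObjectProperty A) [P.ContainsZero]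
    [P.IsClosedUnderKernels] [P.IsClosedUnderCokernels] [P.IsClosedUnderFiniteProducts] :
    PreservesFiniteColimits P.ι :=
  have := P.preservesCokernels_ι
  Functor.preservesFiniteColimits_of_preservesCokernels P.ι

/-! ### Derived categories of an abelian category -/

/-- The conventional derived category symbols `b`, `+`, `-`, `∅`. -/
inductive DerivedSymbol
  /-- bounded complexes -/
  | b
  /-- bounded below complexes -/
  | plus
  /-- bounded above complexes -/
  | minus
  /-- unbounded complexes -/
  | empty

section Derived

variable (A : Type u) [Category.{v} A] [Abelian A] [HasDerivedCategory.{w} A]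

/-- The objects of the unbounded derived category of `A` that lie in `D^⋆(A)`. -/
def DerivedSymbol.property (star : DerivedSymbol) : ObjectProperty (DerivedCategory A) :=
  match star with
  | .b => DerivedCategory.TStructure.t.bounded
  | .plus => DerivedCategory.TStructure.t.plus
  | .minus => DerivedCategory.TStructure.t.minus
  | .empty => ⊤

instance (star : DerivedSymbol) : (star.property A).IsTriangulated := by
  cases star with
  | empty =>
    dsimp only [DerivedSymbol.property]
    exact { ext₂' := fun _ _ _ _ => ObjectProperty.le_isoClosure _ _ trivial }
  | _ => dsimp only [DerivedSymbol.property]; infer_instance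

instance (star : DerivedSymbol) : (star.property A).IsClosedUnderIsomorphisms := by
  cases star <;> dsimp only [DerivedSymbol.property] <;> infer_instance

/-- The derived category `D^⋆(A)`, as a full triangulated subcategory of the unbounded derived
category. For `⋆ = b, +, -` these are `DerivedCategory.Bounded A`, `DerivedCategory.Plus A`,
`DerivedCategory.Minus A`, and for `⋆ = ∅` the condition on the objects is empty. -/
abbrev DStar (star : DerivedSymbol) := (star.property A).FullSubcategory

end Derived

section ExactFunctor

variable {A : Type u₁} [Category.{v₁} A] [Abelian A] [HasDerivedCategory.{w₁} A]
  {B : Type u₂} [Category.{v₂} B] [Abelian B] [HasDerivedCategory.{w₂} B]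
  (F : A ⥤ B) [F.Additive] [PreservesFiniteLimits F] [PreservesFiniteColimits F]

lemma isLE_mapDerivedCategory {X : DerivedCategory A} {n : ℤ} (hX : X.IsLE n) :
    (F.mapDerivedCategory.obj X).IsLE n := by
  obtain ⟨K, e, hK⟩ := hX
  exact ⟨(F.mapHomologicalComplex _).obj K,
    F.mapDerivedCategory.mapIso e ≪≫ F.mapDerivedCategoryFactors.app K, inferInstance⟩

lemma isGE_mapDerivedCategory {X : DerivedCategory A} {n : ℤ} (hX : X.IsGE n) :
    (F.mapDerivedCategory.obj X).IsGE n := by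
  obtain ⟨K, e, hK⟩ := hX
  exact ⟨(F.mapHomologicalComplex _).obj K,
    F.mapDerivedCategory.mapIso e ≪≫ F.mapDerivedCategoryFactors.app K, inferInstance⟩

lemma property_mapDerivedCategory (star : DerivedSymbol) {X : DerivedCategory A}
    (hX : star.property A X) : star.property B (F.mapDerivedCategory.obj X) := by
  cases star with
  | b =>
    obtain ⟨⟨m, hm⟩, ⟨n, hn⟩⟩ := hX
    exact ⟨⟨m, isGE_mapDerivedCategory F hm⟩, ⟨n, isLE_mapDerivedCategory F hn⟩⟩
  | plus =>
    obtain ⟨m, hm⟩ := hX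
    exact ⟨m, isGE_mapDerivedCategory F hm⟩
  | minus =>
    obtain ⟨n, hn⟩ := hX
    exact ⟨n, isLE_mapDerivedCategory F hn⟩
  | empty => trivial

/-- The functor `D^⋆(A) ⥤ D^⋆(B)` induced by an exact functor `A ⥤ B`, by applying that
functor to complexes termwise. -/
def mapDStar (star : DerivedSymbol) : DStar A star ⥤ DStar B star :=
  (star.property B).lift ((star.property A).ι ⋙ F.mapDerivedCategory)
    (fun X => property_mapDerivedCategory F star X.property)

instance (star : DerivedSymbol) : (mapDStar F star).CommShift ℤ := by
  dsimp only [mapDStar]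
  infer_instance

instance (star : DerivedSymbol) : (mapDStar F star).IsTriangulated := by
  dsimp only [mapDStar]
  infer_instance

end ExactFunctor

end TriangulatedMatlis

end

/-! Let `P` be the class of objects of `D^⋆(R-mod)` on which every `s ∈ S` acts invertibly
(`sInvertible`). Torsion complexes have no nonzero maps to `P`, contramodule complexes receive none
from `P`, and every complex `X` admits maps `T → X` and `X → C` with cone in `P`, where `T` is
torsion and `C` is a contramodule complex. As both embeddings are fully faithful on derived
categories, both sides are identified with the quotient by `P`; this is
`exists_equivalence_of_complements`. Objects of `P` come from `D^⋆(S⁻¹R-mod)` because `K → S⁻¹K` is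
a quasi-isomorphism for them.

Torsion side. If `Z → S⁻¹Z` is termwise surjective, its kernel `T` is a torsion complex, the cone of
`T → Z` is `S⁻¹Z`, and every map from a torsion complex to `Z` factors through `T`. Bounded torsion
gives injective modules this surjectivity (`isAdjusted_of_injective`), and the property passes to
quotients, so even unbounded complexes have such resolutions.

Contramodule side. Let `0 → P₁ → P₀ → S⁻¹R → 0` be exact with `P₀` free; `P₁` is projective since
`pd S⁻¹R ≤ 1`. With `L = R ⊕ P₁`, the map `L → P₀` is a projective model of `R → S⁻¹R`. Put `Δ(M) =
coker(Hom(P₀, M) → Hom(L, M))`. It is a contramodule because `L → P₀` becomes invertible after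
tensoring with `S⁻¹R` (`isSContramodule_of_exact`), and `Δ(C) ≅ C` for contramodules `C`. The kernel
and cokernel of `M → Δ(M)` are governed by `Hom` and `Ext¹` out of `S⁻¹R`, where `s` is inverted by
`exists_homotopy`. `Δ` respects quasi-isomorphisms where `Hom(P₀, M) → Hom(L, M)` is injective;
bounded torsion gives this for free modules, and it passes to submodules. -/

namespace TriangulatedMatlis

/-! ### Left and right complements of a triangulated subcategory. -/

section Recollement

variable {T C D : Type*} [Category* T] [Category* C] [Category* D]
  [HasZeroObject D] [Preadditive D] [HasShift D ℤ]
  [∀ n : ℤ, (shiftFunctor D n).Additive] [Pretriangulated D]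

/-- A fully faithful functor has a left adjoint whose unit morphisms lie in `P.trW` if every object
admits a morphism in `P.trW` to an object of its image, and this image is right orthogonal
to `P`. -/
lemma exists_leftAdjoint_of_rightOrthogonal (P : ObjectProperty D) [P.IsTriangulated]
    (j : C ⥤ D) [j.Full] [j.Faithful] (hj : ∀ N, P.rightOrthogonal (j.obj N))
    (h : ∀ X, ∃ (N : C) (t : X ⟶ j.obj N), P.trW t) :
    ∃ (L : D ⥤ C) (adj : L ⊣ j), ∀ X, P.trW (adj.unit.app X) := by
  choose N t ht using h
  -- Since `j.obj Y` is right orthogonal to `P`, maps `X ⟶ j.obj Y` extend uniquely along `t X`. So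
  -- `N X` corepresents `Y ↦ Hom(X, j Y)`.
  have hloc (X : D) (Y : C) :
      Function.Bijective (fun f : j.obj (N X) ⟶ j.obj Y => t X ≫ f) := by
    have := hj Y
    rw [← ObjectProperty.isLocal_trW] at this
    exact this _ (ht X)
  let e (X : D) (Y : C) : (N X ⟶ Y) ≃ (X ⟶ j.obj Y) :=
    (Functor.FullyFaithful.ofFullyFaithful j).homEquiv.trans (Equiv.ofBijective _ (hloc X Y))
  have he (X : D) (Y : C) (f : N X ⟶ Y) : e X Y f = t X ≫ j.map f := rfl
  refine ⟨_, Adjunction.adjunctionOfEquivLeft e (fun X Y Y' g f => by simp [he]), fun X => ?_⟩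
  have : e X (N X) (𝟙 _) = t X := by rw [he, j.map_id, Category.comp_id]
  rw [← Adjunction.homEquiv_id, Adjunction.adjunctionOfEquivLeft, Adjunction.mkOfHomEquiv_homEquiv]
  exact this ▸ ht X

/-- A fully faithful functor has a right adjoint whose counit morphisms lie in `P.trW` if every
object admits a morphism in `P.trW` from an object of its image, and this image is left orthogonal
to `P`. -/
lemma exists_rightAdjoint_of_leftOrthogonal (P : ObjectProperty D) [P.IsTriangulated]
    (i : T ⥤ D) [i.Full] [i.Faithful] (hi : ∀ M, P.leftOrthogonal (i.obj M))
    (h : ∀ X, ∃ (M : T) (t : i.obj M ⟶ X), P.trW t) :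
    ∃ (G : D ⥤ T) (adj : i ⊣ G), ∀ X, P.trW (adj.counit.app X) := by
  choose M t ht using h
  have hloc (X : D) (Y : T) :
      Function.Bijective (fun f : i.obj Y ⟶ i.obj (M X) => f ≫ t X) := by
    have := hi Y
    rw [← ObjectProperty.isColocal_trW] at this
    exact this _ (ht X)
  let e (Y : T) (X : D) : (i.obj Y ⟶ X) ≃ (Y ⟶ M X) :=
    (Equiv.ofBijective _ (hloc X Y)).symm.trans
      (Functor.FullyFaithful.ofFullyFaithful i).homEquiv.symm
  have he (Y : T) (X : D) (f : Y ⟶ M X) : (e Y X).symm f = i.map f ≫ t X := rfl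
  refine ⟨_, Adjunction.adjunctionOfEquivRight e (fun X Y Y' g f => ?_), fun X => ?_⟩
  · rw [← Equiv.eq_symm_apply, he, Functor.map_comp, Category.assoc, ← he, Equiv.symm_apply_apply]
  · have : (e (M X) X).symm (𝟙 _) = t X := by rw [he, i.map_id, Category.id_comp]
    rw [← Adjunction.homEquiv_symm_id, Adjunction.adjunctionOfEquivRight,
      Adjunction.mkOfHomEquiv_homEquiv]
    exact this ▸ ht X

/-- By adjunction `Hom(M, G f)` is `Hom(i M, f)`, which is bijective because `i M` has no nonzero
maps to the cone of `f` or its shifts. -/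
lemma isIso_of_trW_of_leftOrthogonal (P : ObjectProperty D) [P.IsTriangulated] {i : T ⥤ D}
    (hi : ∀ M, P.leftOrthogonal (i.obj M)) {G : D ⥤ T} (adj : i ⊣ G) {X Y : D} (f : X ⟶ Y)
    (hf : P.trW f) : IsIso (G.map f) := by
  refine isIso_of_yoneda_map_bijective _ fun M => ?_
  have := hi M
  rw [← ObjectProperty.isColocal_trW] at this
  have h := (adj.homEquiv M Y).bijective.comp ((this f hf).comp (adj.homEquiv M X).symm.bijective)
  convert h using 1
  ext g
  simp [Adjunction.homEquiv_unit, Adjunction.homEquiv_counit]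

lemma isIso_of_trW_of_rightOrthogonal (P : ObjectProperty D) [P.IsTriangulated] {j : C ⥤ D}
    (hj : ∀ N, P.rightOrthogonal (j.obj N)) {L : D ⥤ C} (adj : L ⊣ j) {X Y : D} (f : X ⟶ Y)
    (hf : P.trW f) : IsIso (L.map f) := by
  refine isIso_of_coyoneda_map_bijective _ fun N => ?_
  have := hj N
  rw [← ObjectProperty.isLocal_trW] at this
  have h := (adj.homEquiv X N).symm.bijective.comp
    ((this f hf).comp (adj.homEquiv Y N).bijective)
  convert h using 1
  ext g
  simp [Adjunction.homEquiv_unit, Adjunction.homEquiv_counit]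

variable [HasZeroObject T] [HasZeroObject C] [Preadditive T] [Preadditive C]
  [HasShift T ℤ] [HasShift C ℤ]
  [∀ n : ℤ, (shiftFunctor T n).Additive] [∀ n : ℤ, (shiftFunctor C n).Additive]
  [Pretriangulated T] [Pretriangulated C]

/-- If a triangulated subcategory `P` has a left complement `i : T ⥤ D` and a right
complement `j : C ⥤ D`, then `T` and `C` are equivalent compatibly with the passage to the Verdier
quotient by `P`. -/
theorem exists_equivalence_of_complements (P : ObjectProperty D) [P.IsTriangulated]
    (i : T ⥤ D) [i.CommShift ℤ] [i.IsTriangulated] [i.Full] [i.Faithful]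
    (j : C ⥤ D) [j.CommShift ℤ] [j.IsTriangulated] [j.Full] [j.Faithful]
    (hi : ∀ M, P.leftOrthogonal (i.obj M)) (hj : ∀ N, P.rightOrthogonal (j.obj N))
    (hi' : ∀ X, ∃ (M : T) (t : i.obj M ⟶ X), P.trW t)
    (hj' : ∀ X, ∃ (N : C) (t : X ⟶ j.obj N), P.trW t) :
    ∃ (E : T ≌ C) (_ : E.functor.CommShift ℤ) (_ : E.inverse.CommShift ℤ) (_ : E.CommShift ℤ)
      (τ : i ⟶ E.functor ⋙ j),
      E.IsTriangulated ∧ NatTrans.CommShift τ ℤ ∧ ∀ M, P.trW (τ.app M) := by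
  obtain ⟨L, adjL, hL⟩ := exists_leftAdjoint_of_rightOrthogonal P j hj hj'
  obtain ⟨G, adjG, hG⟩ := exists_rightAdjoint_of_leftOrthogonal P i hi hi'
  let := adjL.leftAdjointCommShift ℤ
  let := adjG.rightAdjointCommShift ℤ
  have := adjL.commShift_of_rightAdjoint ℤ
  have := adjG.commShift_of_leftAdjoint ℤ
  have := adjL.isTriangulated_leftAdjoint
  have := adjG.isTriangulated_rightAdjoint
  -- This composite is the equivalence: `adjG.unit` and `adjL.counit` are invertible by full
  -- faithfulness, while `G` and `L` invert `P.trW`, hence invert the unit of `adjL` and the counit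
  -- of `adjG`.
  let adj : i ⋙ L ⊣ j ⋙ G := adjG.comp adjL
  have : ∀ M, IsIso (adj.unit.app M) := fun M => by
    have := isIso_of_trW_of_leftOrthogonal P hi adjG _ (hL (i.obj M))
    simp only [adj, Adjunction.comp_unit_app]
    infer_instance
  have : ∀ N, IsIso (adj.counit.app N) := fun N => by
    have := isIso_of_trW_of_rightOrthogonal P hj adjL _ (hG (j.obj N))
    simp only [adj, Adjunction.comp_counit_app]
    infer_instance
  have hadj : adj.CommShift ℤ := by dsimp only [adj]; infer_instance
  let : adj.toEquivalence.functor.CommShift ℤ := inferInstanceAs ((i ⋙ L).CommShift ℤ)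
  let : adj.toEquivalence.inverse.CommShift ℤ := inferInstanceAs ((j ⋙ G).CommShift ℤ)
  have h1 : adj.toEquivalence.CommShift ℤ :=
    { commShift_unit := hadj.commShift_unit
      commShift_counit := hadj.commShift_counit }
  have h2 : adj.toEquivalence.functor.IsTriangulated :=
    inferInstanceAs ((i ⋙ L).IsTriangulated)
  refine ⟨adj.toEquivalence, inferInstance, inferInstance, h1,
    i.rightUnitor.inv ≫ Functor.whiskerLeft i adjL.unit ≫ (i.associator L j).inv,
    .mk' _ h2, ?_, fun M => ?_⟩
  · have : NatTrans.CommShift (i.rightUnitor.inv ≫ Functor.whiskerLeft i adjL.unit ≫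
      (i.associator L j).inv) ℤ := inferInstance
    exact this
  · have e : (i.rightUnitor.inv ≫ Functor.whiskerLeft i adjL.unit ≫
      (i.associator L j).inv).app M = adjL.unit.app (i.obj M) := by simp
    exact e ▸ hL _

end Recollement

/-- A full triangulated functor which reflects zero objects is faithful. -/
lemma faithful_of_full_of_reflectsZero {C D : Type*} [Category* C] [Category* D]
    [HasZeroObject C] [HasZeroObject D] [Preadditive C] [Preadditive D]
    [HasShift C ℤ] [HasShift D ℤ]
    [∀ n : ℤ, (shiftFunctor C n).Additive] [∀ n : ℤ, (shiftFunctor D n).Additive]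
    [Pretriangulated C] [Pretriangulated D] (F : C ⥤ D) [F.CommShift ℤ] [F.IsTriangulated]
    [F.Full] (h : ∀ X, IsZero (F.obj X) → IsZero X) : F.Faithful := by
  have hiso {X Y : C} (f : X ⟶ Y) (hf : IsIso (F.map f)) : IsIso f := by
    obtain ⟨Z, g, k, hT⟩ := distinguished_cocone_triangle f
    exact (Triangle.isZero₃_iff_isIso₁ _ hT).1
      (h _ ((Triangle.isZero₃_iff_isIso₁ _ (F.map_distinguished _ hT)).2 hf))
  have hzero {X Y : C} (f : X ⟶ Y) (hf : F.map f = 0) : f = 0 := by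
    obtain ⟨Z, g, k, hT⟩ := distinguished_cocone_triangle f
    -- As `F f = 0`, the map `F g` is a split monomorphism. Its retraction lifts by fullness, `g ≫
    -- r` is invertible because `F` reflects isomorphisms, and `f ≫ g = 0` then forces `f = 0`.
    obtain ⟨r, hr⟩ : ∃ r : F.obj Z ⟶ F.obj Y, 𝟙 (F.obj Y) = F.map g ≫ r :=
      Triangle.yoneda_exact₂ _ (F.map_distinguished _ hT) _ ((Category.comp_id _).trans hf)
    obtain ⟨r, rfl⟩ := F.map_surjective r
    have : IsIso (g ≫ r) := hiso _ (by
      rw [F.map_comp, ← hr]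
      infer_instance)
    rw [← cancel_mono (g ≫ r), zero_comp, ← Category.assoc,
      show f ≫ g = 0 from comp_distTriang_mor_zero₁₂ _ hT, zero_comp]
  exact ⟨fun {X Y f g} hfg => sub_eq_zero.1 (hzero _ (by rw [F.map_sub, hfg, sub_self]))⟩

/-! ### Boundedness and acyclicity detected by exact faithful functors. -/

section ExactFaithful

variable {A : Type u₁} [Category.{v₁} A] [Abelian A] [HasDerivedCategory.{w₁} A]
  {B : Type u₂} [Category.{v₂} B] [Abelian B] [HasDerivedCategory.{w₂} B]
  (F : A ⥤ B) [F.Additive] [PreservesFiniteLimits F] [PreservesFiniteColimits F] [F.Faithful]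

lemma isGE_of_isGE_mapDerivedCategory {X : DerivedCategory A} {n : ℤ}
    (hX : (F.mapDerivedCategory.obj X).IsGE n) : X.IsGE n := by
  let e := DerivedCategory.Q.objObjPreimageIso X
  have h : (DerivedCategory.Q.obj ((F.mapHomologicalComplex (.up ℤ)).obj
      (DerivedCategory.Q.objPreimage X))).IsGE n :=
    DerivedCategory.TStructure.t.isGE_of_iso
      (F.mapDerivedCategory.mapIso e.symm ≪≫ F.mapDerivedCategoryFactors.app _) n
  refine @DerivedCategory.TStructure.t.isGE_of_iso _ _ _ _ _ _ _ _ _ e n ?_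
  rw [DerivedCategory.isGE_Q_obj_iff, CochainComplex.isGE_iff] at h
  refine (DerivedCategory.isGE_Q_obj_iff _ _).2 ((CochainComplex.isGE_iff _ _).2 ?_)
  exact fun i hi => (ShortComplex.exact_map_iff_of_faithful _ F).1 (h i hi)

lemma isLE_of_isLE_mapDerivedCategory {X : DerivedCategory A} {n : ℤ}
    (hX : (F.mapDerivedCategory.obj X).IsLE n) : X.IsLE n := by
  let e := DerivedCategory.Q.objObjPreimageIso X
  have h : (DerivedCategory.Q.obj ((F.mapHomologicalComplex (.up ℤ)).obj
      (DerivedCategory.Q.objPreimage X))).IsLE n :=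
    DerivedCategory.TStructure.t.isLE_of_iso
      (F.mapDerivedCategory.mapIso e.symm ≪≫ F.mapDerivedCategoryFactors.app _) n
  refine @DerivedCategory.TStructure.t.isLE_of_iso _ _ _ _ _ _ _ _ _ e n ?_
  rw [DerivedCategory.isLE_Q_obj_iff, CochainComplex.isLE_iff] at h
  refine (DerivedCategory.isLE_Q_obj_iff _ _).2 ((CochainComplex.isLE_iff _ _).2 ?_)
  exact fun i hi => (ShortComplex.exact_map_iff_of_faithful _ F).1 (h i hi)

/-- An exact faithful functor detects exactness in each degree. This places the torsion and
contramodule complexes constructed below in `D^⋆`, by looking only at their underlying complexes of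
modules. -/
lemma property_of_property_mapDerivedCategory (star : DerivedSymbol) {X : DerivedCategory A}
    (hX : star.property B (F.mapDerivedCategory.obj X)) : star.property A X := by
  cases star with
  | b =>
    obtain ⟨⟨m, hm⟩, ⟨n, hn⟩⟩ := hX
    exact ⟨⟨m, isGE_of_isGE_mapDerivedCategory F hm⟩, ⟨n, isLE_of_isLE_mapDerivedCategory F hn⟩⟩
  | plus =>
    obtain ⟨m, hm⟩ := hX
    exact ⟨m, isGE_of_isGE_mapDerivedCategory F hm⟩
  | minus =>
    obtain ⟨n, hn⟩ := hX
    exact ⟨n, isLE_of_isLE_mapDerivedCategory F hn⟩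
  | empty => trivial

lemma isZero_of_isZero_mapDerivedCategory (X : DerivedCategory A)
    (hX : IsZero (F.mapDerivedCategory.obj X)) : IsZero X := by
  have h (n : ℤ) : X.IsGE n := isGE_of_isGE_mapDerivedCategory F
    ((DerivedCategory.isGE_iff _ _).2 fun i _ => Functor.map_isZero _ hX)
  rw [IsZero.iff_id_eq_zero]
  have : IsIso (0 : X ⟶ X) := by
    rw [DerivedCategory.isIso_iff]
    intro n
    have hn := (DerivedCategory.isGE_iff _ _).1 (h (n + 1)) n (by lia)
    exact ⟨0, hn.eq_of_src _ _, hn.eq_of_src _ _⟩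
  rw [← cancel_mono (0 : X ⟶ X), comp_zero, comp_zero]

omit [F.Faithful] in
lemma mapDStar_full [F.mapDerivedCategory.Full] (star : DerivedSymbol) :
    (mapDStar F star).Full := by
  dsimp only [mapDStar]
  infer_instance

lemma mapDStar_faithful [F.mapDerivedCategory.Full] (star : DerivedSymbol) :
    (mapDStar F star).Faithful := by
  have := faithful_of_full_of_reflectsZero F.mapDerivedCategory
    (isZero_of_isZero_mapDerivedCategory F)
  dsimp only [mapDStar]
  infer_instance

end ExactFaithful

/-! ### Resolutions of unbounded complexes. -/

section Resolutions

variable {A : Type u} [Category.{v} A] [Abelian A]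

/-- The cochain complex `I n ⊞ I (n + 1)` with differential `(a, b) ↦ (b, 0)`. -/
noncomputable def diskComplex (I : ℤ → A) : CochainComplex A ℤ :=
  CochainComplex.of (fun n => I n ⊞ I (n + 1)) (fun _ => biprod.snd ≫ biprod.inl) (by simp)

/-- Disk complexes are cofree: the graded map `e` determines the chain map `x ↦ (e x, e (d x))`. -/
lemma exists_mono_diskComplex (X : CochainComplex A ℤ) {I : ℤ → A} (e : ∀ n, X.X n ⟶ I n)
    [∀ n, Mono (e n)] : ∃ f : X ⟶ diskComplex I, Mono f := by
  let f : X ⟶ diskComplex I :=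
    { f n := biprod.lift (e n) (X.d n (n + 1) ≫ e (n + 1))
      comm' := by
        rintro n _ rfl
        dsimp [diskComplex]
        rw [CochainComplex.of_d]
        ext <;> simp }
  have (n : ℤ) : Mono (f.f n) := by
    have : Mono (f.f n ≫ (biprod.fst : I n ⊞ I (n + 1) ⟶ I n)) := by
      dsimp [f, diskComplex]
      rw [biprod.lift_fst]
      infer_instance
    exact mono_of_mono _ (biprod.fst : I n ⊞ I (n + 1) ⟶ I n)
  exact ⟨f, HomologicalComplex.mono_of_mono_f _ this⟩

/-- Disk complexes are also free, via `(a, b) ↦ d (p a) + p b`. Here `I j` covers the term in degree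
`j - 1`; quantifying over `i + 1 = j` avoids transport along equalities of degrees. -/
lemma exists_epi_diskComplex (X : CochainComplex A ℤ) {I : ℤ → A}
    (p : ∀ i j, i + 1 = j → (I j ⟶ X.X i)) (hp : ∀ i j hij, Epi (p i j hij)) :
    ∃ f : diskComplex I ⟶ X, Epi f := by
  have key (n m : ℤ) (h : m + 1 = n + 1) :
      p m (n + 1) h ≫ X.d m (n + 1) = p n (n + 1) rfl ≫ X.d n (n + 1) := by
    obtain rfl : m = n := by lia
    rfl
  let f : diskComplex I ⟶ X :=
    { f n := biprod.desc (p (n - 1) n (by lia) ≫ X.d (n - 1) n) (p n (n + 1) rfl)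
      comm' := by
        rintro n _ rfl
        dsimp [diskComplex]
        rw [CochainComplex.of_d]
        ext <;> simp [key] }
  have (n : ℤ) : Epi (f.f n) := by
    have : Epi ((biprod.inr : _ ⟶ I n ⊞ I (n + 1)) ≫ f.f n) := by
      dsimp [f, diskComplex]
      rw [biprod.inr_desc]
      exact hp _ _ _
    exact epi_of_epi (biprod.inr : _ ⟶ I n ⊞ I (n + 1)) _
  exact ⟨f, HomologicalComplex.epi_of_epi_f _ this⟩

lemma prop_mappingCone_X (P : ObjectProperty A) [P.IsClosedUnderIsomorphisms]
    (hb : ∀ M N, P M → P N → P (M ⊞ N)) {K L : CochainComplex A ℤ} (φ : K ⟶ L)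
    (hK : ∀ n, P (K.X n)) (hL : ∀ n, P (L.X n)) (n : ℤ) :
    P ((CochainComplex.mappingCone φ).X n) :=
  P.prop_of_iso (HomologicalComplex.homotopyCofiber.XIsoBiprod φ n (n + 1) rfl).symm
    (hb _ _ (hK _) (hL _))

/-- A complex has a left resolution by a class of objects closed under subobjects and finite sums
which covers every object. -/
theorem exists_quasiIso_from (P : ObjectProperty A) [P.IsClosedUnderIsomorphisms]
    (hb : ∀ M N, P M → P N → P (M ⊞ N)) (hs : ∀ {M N : A} (f : M ⟶ N) [Mono f], P N → P M)
    (hP : ∀ M, ∃ (N : A) (p : N ⟶ M), Epi p ∧ P N) (X : CochainComplex A ℤ) :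
    ∃ (Y : CochainComplex A ℤ) (s : Y ⟶ X), QuasiIso s ∧ ∀ n, P (Y.X n) := by
  have h (m : ℤ) : ∃ (I : A) (p : ∀ i, i + 1 = m → (I ⟶ X.X i)),
      P I ∧ ∀ i hi, Epi (p i hi) := by
    obtain ⟨n, rfl⟩ : ∃ n, m = n + 1 := ⟨m - 1, by lia⟩
    obtain ⟨I, p, hp, hI⟩ := hP (X.X n)
    refine ⟨I, fun i hi => p ≫ eqToHom (by rw [show n = i by lia]), hI,
      fun i hi => ?_⟩
    obtain rfl : i = n := by lia
    simpa
  choose I p hI hp using h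
  -- The kernel of `g` has terms in `P` by closure under subobjects, so the cone of its inclusion
  -- resolves `X` in one step, with no boundedness needed.
  obtain ⟨g, hg⟩ := exists_epi_diskComplex X (fun i j hij => p j i hij) (fun i j hij => hp j i hij)
  have hJ (n : ℤ) : P ((diskComplex I).X n) := hb _ _ (hI _) (hI _)
  let S := ShortComplex.mk (kernel.ι g) g (kernel.condition g)
  have hS : S.ShortExact :=
    { exact := ShortComplex.exact_of_f_is_kernel _ (kernelIsKernel g)
      mono_f := inferInstanceAs (Mono (kernel.ι g))
      epi_g := hg }
  exact ⟨_, CochainComplex.mappingCone.descShortComplex S,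
    CochainComplex.mappingCone.quasiIso_descShortComplex hS,
    prop_mappingCone_X P hb _ (fun n => hs ((kernel.ι g).f n) (hJ n)) hJ⟩

section MappingCocone

open CochainComplex HomComplex

lemma mappingCocone_fst_f {K L : CochainComplex A ℤ} (φ : K ⟶ L) (p : ℤ) :
    (mappingCocone.fst φ).f p =
      - ((mappingCone.fst φ).1.leftShift (-1) 0 (add_neg_cancel 1)).v p p (add_zero p) := by
  simp [mappingCocone.fst]
  rfl

lemma δ_mappingCocone_snd {K L : CochainComplex A ℤ} (φ : K ⟶ L) :
    δ (-1) 0 (mappingCocone.snd φ) = - Cochain.ofHom (mappingCocone.fst φ ≫ φ) := by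
  have h := Cochain.δ_leftShift (mappingCone.snd φ) (-1) (-1) 0 (by lia) 1 (by lia)
  rw [mappingCone.δ_snd] at h
  refine h.trans ?_
  ext p
  have e : (- Cochain.ofHom (mappingCocone.fst φ ≫ φ)).v p p (add_zero p) =
    - ((mappingCocone.fst φ).f p ≫ φ.f p) := by simp
  refine Eq.trans ?_ e.symm
  rw [mappingCocone_fst_f]
  simp [Cochain.leftShift_v (n := 1) _ _ _ _ _ p _ (p + -1) (by lia)]
  have key (a : (mappingCone φ).X (p + -1) ⟶ K.X p) :
    (-a) ≫ φ.f p = - ((- -a) ≫ φ.f p) := by simp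
  exact key _

variable {X J C : CochainComplex A ℤ} (f : X ⟶ J) (π : J ⟶ C) (w : f ≫ π = 0)
  (hS : (ShortComplex.mk f π w).ShortExact)

include hS in
/-- If `0 → X → J → C → 0` is exact, then `X` is quasi-isomorphic to the mapping cocone
of `J ⟶ C`. -/
lemma quasiIso_mappingCocone_lift :
    QuasiIso (mappingCocone.lift π f 0 (by simp [w])) := by
  let ℓ : X ⟶ mappingCocone π := mappingCocone.lift π f 0 (by simp [w])
  -- In components `ρ` is `(x, c) ↦ (π x, c)`. It is termwise surjective with kernel `X`, and its
  -- target is acyclic.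
  let ρ : mappingCocone π ⟶ mappingCocone (𝟙 C) :=
    mappingCocone.lift (𝟙 C) (mappingCocone.fst π ≫ π) (mappingCocone.snd π)
      (by rw [δ_mappingCocone_snd, Category.comp_id, neg_add_cancel])
  have hfst (n : ℤ) : ℓ.f n ≫ (mappingCocone.fst π).f n = f.f n :=
    mappingCocone.lift_f_fst_f _ _ _ _ _
  have hsnd (n : ℤ) : ℓ.f n ≫ (mappingCocone.snd π).v n (n + -1) rfl = 0 := by
    simpa using mappingCocone.lift_f_snd_v π f 0 (by simp [w]) n (n + -1) rfl
  have hfst' (n : ℤ) : ρ.f n ≫ (mappingCocone.fst (𝟙 C)).f n =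
      (mappingCocone.fst π).f n ≫ π.f n := mappingCocone.lift_f_fst_f _ _ _ _ _
  have hsnd' (n : ℤ) : ρ.f n ≫ (mappingCocone.snd (𝟙 C)).v n (n + -1) rfl =
      (mappingCocone.snd π).v n (n + -1) rfl := mappingCocone.lift_f_snd_v _ _ _ _ _ _ _
  have ext {K L : CochainComplex A ℤ} (φ : K ⟶ L) {n : ℤ} {W : A}
      {a b : W ⟶ (mappingCocone φ).X n}
      (h₁ : a ≫ (mappingCocone.fst φ).f n = b ≫ (mappingCocone.fst φ).f n)
      (h₂ : a ≫ (mappingCocone.snd φ).v n (n + -1) rfl =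
        b ≫ (mappingCocone.snd φ).v n (n + -1) rfl) : a = b := by
    rw [← Category.comp_id a, ← Category.comp_id b, ← mappingCocone.id_X φ n (n + -1) rfl]
    simp only [Preadditive.comp_add, reassoc_of% h₁, reassoc_of% h₂]
  have hw : ℓ ≫ ρ = 0 := by
    ext n
    refine ext _ ?_ ?_
    · have : f.f n ≫ π.f n = 0 := by rw [← HomologicalComplex.comp_f, w]; rfl
      simp [hfst', reassoc_of% hfst, this]
    · simp [hsnd', hsnd]
  have hT : (ShortComplex.mk ℓ ρ hw).ShortExact := by
    refine HomologicalComplex.shortExact_of_degreewise_shortExact _ fun n => ?_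
    have hn := (HomologicalComplex.shortExact_iff_degreewise_shortExact _).1 hS n
    have : Mono (f.f n) := hn.mono_f
    have : Epi (π.f n) := hn.epi_g
    have : Mono (ℓ.f n) := by
      have : Mono (ℓ.f n ≫ (mappingCocone.fst π).f n) := by rwa [hfst]
      exact mono_of_mono _ ((mappingCocone.fst π).f n)
    have hinl : (mappingCocone.inl π).v n n (add_zero n) ≫ ρ.f n =
        π.f n ≫ (mappingCocone.inl (𝟙 C)).v n n (add_zero n) :=
      ext _ (by simp [hfst']) (by simp [hsnd'])
    have hinr : (mappingCocone.inr π).1.v (n + -1) n (by lia) ≫ ρ.f n =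
        (mappingCocone.inr (𝟙 C)).1.v (n + -1) n (by lia) :=
      ext _ (by simp [hfst']) (by simp [hsnd'])
    have : Epi (ρ.f n) := by
      rw [Preadditive.epi_iff_cancel_zero]
      intro W g hg
      have h₁ : (mappingCocone.inl (𝟙 C)).v n n (add_zero n) ≫ g = 0 := by
        rw [← cancel_epi (π.f n), ← reassoc_of% hinl, hg, comp_zero, comp_zero]
      have h₂ : (mappingCocone.inr (𝟙 C)).1.v (n + -1) n (by lia) ≫ g = 0 := by
        rw [← reassoc_of% hinr, hg, comp_zero]
      rw [← Category.id_comp g, ← mappingCocone.id_X (𝟙 C) n (n + -1) rfl]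
      simp [h₁, h₂]
    have key {W : A} (k : W ⟶ (mappingCocone π).X n) (hk : k ≫ ρ.f n = 0) :
        ∃ l : W ⟶ X.X n, l ≫ ℓ.f n = k := by
      have h₁ : (k ≫ (mappingCocone.fst π).f n) ≫ π.f n = 0 := by
        rw [Category.assoc, ← hfst', reassoc_of% hk, zero_comp]
      obtain ⟨l, hl⟩ : ∃ l : W ⟶ X.X n, l ≫ f.f n = k ≫ (mappingCocone.fst π).f n := by
        have := hn.mono_f
        exact ⟨hn.exact.lift _ h₁, hn.exact.lift_f _ h₁⟩
      refine ⟨l, ext _ ?_ ?_⟩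
      · rw [Category.assoc, hfst, hl]
      · rw [Category.assoc, hsnd, comp_zero, ← hsnd', reassoc_of% hk, zero_comp]
    let T := (ShortComplex.mk ℓ ρ hw).map (HomologicalComplex.eval A (.up ℤ) n)
    have : Mono T.f := ‹Mono (ℓ.f n)›
    have : Epi T.g := ‹Epi (ρ.f n)›
    suffices T.Exact from { exact := this }
    refine ShortComplex.exact_of_f_is_kernel _
      (KernelFork.IsLimit.ofι' _ _ fun {W} k hk => ⟨_, (key k hk).choose_spec⟩)
  let := HasDerivedCategory.standard A
  rw [← DerivedCategory.isIso_Q_map_iff_quasiIso]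
  have h₀ : IsZero (DerivedCategory.Q.obj (mappingCocone (𝟙 C))) := by
    have := (Triangle.isZero₁_iff_isIso₂ _
      (DerivedCategory.mappingCocone_triangle_distinguished (𝟙 C))).2
    exact this (inferInstanceAs (IsIso (DerivedCategory.Q.map (𝟙 C))))
  exact (Triangle.isZero₃_iff_isIso₁ _ (DerivedCategory.triangleOfSES_distinguished hT)).1 h₀

end MappingCocone

lemma prop_mappingCocone_X (P : ObjectProperty A) [P.IsClosedUnderIsomorphisms]
    (hb : ∀ M N, P M → P N → P (M ⊞ N)) {K L : CochainComplex A ℤ} (φ : K ⟶ L)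
    (hK : ∀ n, P (K.X n)) (hL : ∀ n, P (L.X n)) (n : ℤ) :
    P ((CochainComplex.mappingCocone φ).X n) :=
  prop_mappingCone_X P hb φ hK hL (n + -1)

/-- A complex has a right resolution by a class of objects closed under quotients and finite sums
into which every object embeds. -/
theorem exists_quasiIso_to (P : ObjectProperty A) [P.IsClosedUnderIsomorphisms]
    (hb : ∀ M N, P M → P N → P (M ⊞ N)) (hq : ∀ {M N : A} (f : M ⟶ N) [Epi f], P M → P N)
    (hP : ∀ M, ∃ (N : A) (e : M ⟶ N), Mono e ∧ P N) (X : CochainComplex A ℤ) :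
    ∃ (Y : CochainComplex A ℤ) (s : X ⟶ Y), QuasiIso s ∧ ∀ n, P (Y.X n) := by
  choose I e he hI using fun n => hP (X.X n)
  obtain ⟨f, hf⟩ := exists_mono_diskComplex X e
  have hJ (n : ℤ) : P ((diskComplex I).X n) := hb _ _ (hI _) (hI _)
  have hS : (ShortComplex.mk f (cokernel.π f) (cokernel.condition f)).ShortExact :=
    { exact := ShortComplex.exact_of_g_is_cokernel _ (cokernelIsCokernel f)
      mono_f := hf
      epi_g := inferInstanceAs (Epi (cokernel.π f)) }
  exact ⟨_, _, quasiIso_mappingCocone_lift f _ _ hS,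
    prop_mappingCocone_X P hb _ hJ (fun n => hq ((cokernel.π f).f n) (hJ n))⟩

end Resolutions

section

variable {A : Type u₁} [Category.{v₁} A] [Abelian A] {B : Type u₂} [Category.{v₂} B] [Abelian B]

/-- A natural transformation between exact functors induces a quasi-isomorphism on a complex
if it is an isomorphism on its cohomology. -/
lemma quasiIso_mapHomologicalComplex_app {F G : A ⥤ B} [F.Additive] [G.Additive]
    [PreservesFiniteLimits F] [PreservesFiniteColimits F]
    [PreservesFiniteLimits G] [PreservesFiniteColimits G] (τ : F ⟶ G) (K : CochainComplex A ℤ)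
    (h : ∀ n, IsIso (τ.app (K.homology n))) :
    QuasiIso ((NatTrans.mapHomologicalComplex τ (.up ℤ)).app K) := by
  refine ⟨fun n => ?_⟩
  rw [quasiIsoAt_iff]
  change ShortComplex.QuasiIso ((K.sc n).mapNatTrans τ)
  rw [ShortComplex.quasiIso_iff, ShortComplex.homologyMap_mapNatTrans]
  have : IsIso (τ.app (K.sc n).homology) := h n
  infer_instance

end

/-! ### Localization, and objects on which `S` acts invertibly. -/

section Localization

variable {R : Type u} [CommRing R] (S : Submonoid R)

/-- The `R`-modules on which the elements of `S` act bijectively. -/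
def isSInvertible : ObjectProperty (ModuleCat.{u} R) :=
  fun M => ∀ s ∈ S, Function.Bijective (fun x : M => s • x)

/-- The exact functor `M ↦ S⁻¹M` on `R`-modules. -/
noncomputable abbrev locFunctor : ModuleCat.{u} R ⥤ ModuleCat.{u} R :=
  ModuleCat.localizedModuleFunctor S ⋙ ModuleCat.restrictScalars (algebraMap R (Localization S))

/-- The natural map `M → S⁻¹M`. -/
noncomputable def locUnit : 𝟭 (ModuleCat.{u} R) ⟶ locFunctor S where
  app M := ModuleCat.ofHom
    (Y := (ModuleCat.restrictScalars (algebraMap R (Localization S))).obj (M.localizedModule S))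
    { toFun := M.localizedModuleMkLinearMap S
      map_add' := map_add _
      map_smul' r x := by
        rw [map_smul]
        exact (algebraMap_smul (Localization S) r (M.localizedModuleMkLinearMap S x)).symm }
  naturality M N f := by
    ext x
    exact (IsLocalizedModule.map_apply S (M.localizedModuleMkLinearMap S)
      (N.localizedModuleMkLinearMap S) f.hom x).symm

variable {S}

lemma locUnit_app_eq_zero_iff {M : ModuleCat.{u} R} {x : M} :
    (locUnit S).app M x = 0 ↔ ∃ s ∈ S, s • x = 0 := by
  refine (IsLocalizedModule.eq_zero_iff S (M.localizedModuleMkLinearMap S)).trans ?_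
  exact ⟨fun ⟨c, hc⟩ => ⟨c, c.2, hc⟩, fun ⟨s, hs, h⟩ => ⟨⟨s, hs⟩, h⟩⟩

lemma exists_smul_eq_locUnit_app {M : ModuleCat.{u} R} (y : (locFunctor S).obj M) :
    ∃ s ∈ S, ∃ x : M, s • y = (locUnit S).app M x := by
  obtain ⟨⟨x, s⟩, h⟩ := IsLocalizedModule.surj S (M.localizedModuleMkLinearMap S) y
  refine ⟨s, s.2, x, ?_⟩
  refine Eq.trans ?_ h
  exact algebraMap_smul (Localization S) (s : R) (show M.localizedModule S from y)

lemma isSInvertible_restrictScalars (N : ModuleCat.{u} (Localization S)) :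
    isSInvertible S ((ModuleCat.restrictScalars (algebraMap R (Localization S))).obj N) := by
  intro s hs
  obtain ⟨t, ht⟩ := IsLocalization.map_units (Localization S) (⟨s, hs⟩ : S)
  have h : Function.Bijective (fun x : N => t • x) := MulAction.bijective t
  simp only [Units.smul_def, ht] at h
  exact h

lemma isIso_locUnit_app {M : ModuleCat.{u} R} (hM : isSInvertible S M) :
    IsIso ((locUnit S).app M) := by
  rw [ConcreteCategory.isIso_iff_bijective]
  constructor
  · refine (injective_iff_map_eq_zero ((locUnit S).app M).hom).2 fun x hx => ?_
    obtain ⟨s, hs, h⟩ := locUnit_app_eq_zero_iff.1 hx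
    exact (hM s hs).1 (h.trans (smul_zero s).symm)
  · intro y
    obtain ⟨s, hs, x, h⟩ := exists_smul_eq_locUnit_app y
    obtain ⟨x', rfl⟩ := (hM s hs).2 x
    refine ⟨x', ((isSInvertible_restrictScalars _) s hs).1 ?_⟩
    exact (map_smul ((locUnit S).app M).hom s x').symm.trans h.symm

lemma isZero_locFunctor_obj {M : ModuleCat.{u} R} (hM : isSTorsion S M) :
    IsZero ((locFunctor S).obj M) := by
  refine @ModuleCat.isZero_of_subsingleton _ _ _ (subsingleton_of_forall_eq 0 fun y => ?_)
  obtain ⟨s, hs, x, h⟩ := exists_smul_eq_locUnit_app y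
  rw [locUnit_app_eq_zero_iff.2 (hM x)] at h
  exact (isSInvertible_restrictScalars _ s hs).1 (h.trans (smul_zero s).symm)

lemma isSInvertible_iff_isIso {M : ModuleCat.{u} R} :
    isSInvertible S M ↔ ∀ s ∈ S, IsIso (s • 𝟙 M) := by
  refine forall₂_congr fun s hs => ?_
  rw [ConcreteCategory.isIso_iff_bijective]
  rfl

end Localization

section Derived

variable {R : Type u} [CommRing R] (S : Submonoid R) [HasDerivedCategory.{w} (ModuleCat.{u} R)]

/-- The objects of `D(R-mod)` on which the elements of `S` act invertibly. -/
def sInvertible : ObjectProperty (DerivedCategory (ModuleCat.{u} R)) :=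
  fun X => ∀ s ∈ S, IsIso (s • 𝟙 X)

instance : (sInvertible S).IsClosedUnderIsomorphisms where
  of_iso {X Y} e h s hs := by
    have := h s hs
    have : s • 𝟙 Y = e.inv ≫ (s • 𝟙 X) ≫ e.hom := by simp
    rw [this]
    infer_instance

instance : (sInvertible S).IsTriangulated where
  exists_zero := by
    obtain ⟨Z, hZ⟩ := HasZeroObject.zero (C := DerivedCategory (ModuleCat.{u} R))
    exact ⟨Z, hZ, fun s _ => ⟨0, hZ.eq_of_src _ _, hZ.eq_of_src _ _⟩⟩
  isStableUnderShiftBy n := ⟨fun X hX s hs => by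
    have := hX s hs
    have : s • 𝟙 (X⟦n⟧) = (s • 𝟙 X)⟦n⟧' := by simp [Functor.map_smul]
    rw [this]
    infer_instance⟩
  toIsTriangulatedClosed₂ := .mk' fun T hT h₁ h₃ s hs => by
    let φ : T ⟶ T :=
      { hom₁ := s • 𝟙 _
        hom₂ := s • 𝟙 _
        hom₃ := s • 𝟙 _
        comm₃ := by simp [Functor.map_smul] }
    exact isIso₂_of_isIso₁₃ φ hT hT (h₁ s hs) (h₃ s hs)

variable {S}

lemma sInvertible_Q_obj {K : CochainComplex (ModuleCat.{u} R) ℤ}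
    (hK : ∀ n, isSInvertible S (K.X n)) : sInvertible S (DerivedCategory.Q.obj K) := by
  intro s hs
  have (n : ℤ) : IsIso ((s • 𝟙 K : K ⟶ K).f n) := isSInvertible_iff_isIso.1 (hK n) s hs
  have : IsIso (s • 𝟙 K) := HomologicalComplex.Hom.isIso_of_components _
  have e : s • 𝟙 (DerivedCategory.Q.obj K) = DerivedCategory.Q.map (s • 𝟙 K) := by
    rw [Functor.map_smul, CategoryTheory.Functor.map_id]
  rw [e]
  infer_instance

lemma isSInvertible_homology {K : CochainComplex (ModuleCat.{u} R) ℤ}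
    (hK : sInvertible S (DerivedCategory.Q.obj K)) (n : ℤ) : isSInvertible S (K.homology n) := by
  rw [isSInvertible_iff_isIso]
  intro s hs
  have e : s • 𝟙 (DerivedCategory.Q.obj K) = DerivedCategory.Q.map (s • 𝟙 K) := by
    rw [Functor.map_smul, CategoryTheory.Functor.map_id]
  have h := hK s hs
  rw [e, DerivedCategory.isIso_Q_map_iff_quasiIso, quasiIso_iff] at h
  have h := h n
  rw [quasiIsoAt_iff, ShortComplex.quasiIso_iff] at h
  have e' : (HomologicalComplex.shortComplexFunctor (ModuleCat.{u} R) (.up ℤ) n).map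
    (s • 𝟙 K) = s • 𝟙 (K.sc n) := rfl
  rw [e', ShortComplex.homologyMap_smul, ShortComplex.homologyMap_id] at h
  exact h

/-- Localization is exact, so invertibility of `S` on the cohomology is enough. Hence such a `K` may
be replaced by a complex of `S⁻¹R`-modules. -/
lemma quasiIso_locUnit {K : CochainComplex (ModuleCat.{u} R) ℤ}
    (hK : sInvertible S (DerivedCategory.Q.obj K)) :
    QuasiIso ((NatTrans.mapHomologicalComplex (locUnit S) (.up ℤ)).app K) :=
  quasiIso_mapHomologicalComplex_app _ _ fun n => isIso_locUnit_app (isSInvertible_homology hK n)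

end Derived

/-! ### Fullness on derived categories by calculus of fractions. -/

section Full

variable {A : Type u₁} [Category.{v₁} A] [Abelian A] [HasDerivedCategory.{w₁} A]
  {B : Type u₂} [Category.{v₂} B] [Abelian B] [HasDerivedCategory.{w₂} B]
  (F : A ⥤ B) [F.Additive] [PreservesFiniteLimits F] [PreservesFiniteColimits F]

open DerivedCategory

lemma full_mapDerivedCategory (h : ∀ (M N : CochainComplex A ℤ)
    (f : Q.obj ((F.mapHomologicalComplex (.up ℤ)).obj M) ⟶
      Q.obj ((F.mapHomologicalComplex (.up ℤ)).obj N)), ∃ f' : Q.obj M ⟶ Q.obj N,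
      F.mapDerivedCategory.map f' =
        F.mapDerivedCategoryFactors.hom.app M ≫ f ≫ F.mapDerivedCategoryFactors.inv.app N) :
    F.mapDerivedCategory.Full where
  map_surjective {X Y} f := by
    let eX := Q.objObjPreimageIso X
    let eY := Q.objObjPreimageIso Y
    obtain ⟨f', hf'⟩ := h _ _ (F.mapDerivedCategoryFactors.inv.app _ ≫
      F.mapDerivedCategory.map eX.hom ≫ f ≫ F.mapDerivedCategory.map eY.inv ≫
        F.mapDerivedCategoryFactors.hom.app _)
    refine ⟨eX.inv ≫ f' ≫ eY.hom, ?_⟩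
    rw [Functor.map_comp, Functor.map_comp, hf']
    simp [← Functor.map_comp, ← Functor.map_comp_assoc]

variable [F.Faithful]

lemma quasiIso_of_isIso_Q_map {M N : CochainComplex A ℤ} (s : M ⟶ N)
    (hs : IsIso (Q.map ((F.mapHomologicalComplex (.up ℤ)).map s))) : IsIso (Q.map s) := by
  rw [isIso_Q_map_iff_quasiIso] at hs ⊢
  exact (HomologicalComplex.quasiIso_map_iff_of_preservesHomology s F).1 hs

/-- A roof formed by maps over `A` is already a roof in `D(A)`, since an exact faithful functor
reflects quasi-isomorphisms. -/
lemma full_mapDerivedCategory_of_left_fac (h : ∀ (M N : CochainComplex A ℤ)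
    (f : Q.obj ((F.mapHomologicalComplex (.up ℤ)).obj M) ⟶
      Q.obj ((F.mapHomologicalComplex (.up ℤ)).obj N)),
      ∃ (W : CochainComplex A ℤ) (g : M ⟶ W) (s : N ⟶ W),
      IsIso (Q.map ((F.mapHomologicalComplex (.up ℤ)).map s)) ∧
        f ≫ Q.map ((F.mapHomologicalComplex (.up ℤ)).map s) =
          Q.map ((F.mapHomologicalComplex (.up ℤ)).map g)) :
    F.mapDerivedCategory.Full := full_mapDerivedCategory F fun M N f => by
  obtain ⟨W, g, s, hs, hf⟩ := h M N f
  have := quasiIso_of_isIso_Q_map F s hs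
  refine ⟨Q.map g ≫ inv (Q.map s), ?_⟩
  rw [Functor.map_comp, Functor.map_inv, IsIso.comp_inv_eq, ← cancel_mono
    (F.mapDerivedCategoryFactors.hom.app W)]
  simp only [Category.assoc, Functor.mapDerivedCategoryFactors_hom_naturality,
    Iso.inv_hom_id_app_assoc]
  rw [hf]

lemma full_mapDerivedCategory_of_right_fac (h : ∀ (M N : CochainComplex A ℤ)
    (f : Q.obj ((F.mapHomologicalComplex (.up ℤ)).obj M) ⟶
      Q.obj ((F.mapHomologicalComplex (.up ℤ)).obj N)),
      ∃ (W : CochainComplex A ℤ) (s : W ⟶ M) (g : W ⟶ N),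
      IsIso (Q.map ((F.mapHomologicalComplex (.up ℤ)).map s)) ∧
        Q.map ((F.mapHomologicalComplex (.up ℤ)).map s) ≫ f =
          Q.map ((F.mapHomologicalComplex (.up ℤ)).map g)) :
    F.mapDerivedCategory.Full := full_mapDerivedCategory F fun M N f => by
  obtain ⟨W, s, g, hs, hf⟩ := h M N f
  have := quasiIso_of_isIso_Q_map F s hs
  refine ⟨inv (Q.map s) ≫ Q.map g, ?_⟩
  rw [Functor.map_comp, Functor.map_inv, IsIso.inv_comp_eq, ← cancel_mono
    (F.mapDerivedCategoryFactors.hom.app N), Functor.mapDerivedCategoryFactors_hom_naturality,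
    ← hf]
  simp only [Category.assoc, Functor.mapDerivedCategoryFactors_hom_naturality_assoc,
    Iso.inv_hom_id_app, Functor.comp_obj, Category.comp_id]

end Full

section SES

variable {A : Type u₁} [Category.{v₁} A] [Abelian A]

/-- A morphism of complexes which is termwise in an object property lifts to the full
subcategory. -/
lemma exists_lift_hom {P : ObjectProperty A} [P.ContainsZero] [P.IsClosedUnderKernels]
    [P.IsClosedUnderCokernels] [P.IsClosedUnderFiniteProducts]
    {K L : CochainComplex P.FullSubcategory ℤ}
    (f : (P.ι.mapHomologicalComplex (.up ℤ)).obj K ⟶ (P.ι.mapHomologicalComplex (.up ℤ)).obj L) :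
    ∃ g : K ⟶ L, (P.ι.mapHomologicalComplex (.up ℤ)).map g = f :=
  ⟨{ f n := ObjectProperty.homMk (f.f n)
     comm' i j hij := by
      ext
      exact f.comm i j }, rfl⟩

end SES

/-! ### Modules with surjective localization map. -/

section Torsion

variable {R : Type u} [CommRing R] (S : Submonoid R)

/-- The `R`-modules `M` such that `M → S⁻¹M` is surjective. -/
def isAdjusted : ObjectProperty (ModuleCat.{u} R) := fun M => Epi ((locUnit S).app M)

instance : (isAdjusted S).IsClosedUnderIsomorphisms where
  of_iso {M N} e h := by
    have : Epi ((locUnit S).app M) := h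
    have h' := (locUnit S).naturality e.inv
    have : (locUnit S).app N = e.inv ≫ (locUnit S).app M ≫ (locFunctor S).map e.hom := by
      rw [← (locUnit S).naturality]
      simp
    change Epi _
    rw [this]
    infer_instance

lemma isAdjusted_of_epi {M N : ModuleCat.{u} R} (f : M ⟶ N) [Epi f] (hM : isAdjusted S M) :
    isAdjusted S N := by
  have : Epi ((locUnit S).app M) := hM
  have : Epi (f ≫ (locUnit S).app N) := by
    rw [show f ≫ _ = _ from (locUnit S).naturality f]
    infer_instance
  exact epi_of_epi f _

lemma isAdjusted_biprod (M N : ModuleCat.{u} R) (hM : isAdjusted S M) (hN : isAdjusted S N) :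
    isAdjusted S (M ⊞ N) := by
  have : Epi ((locUnit S).app M) := hM
  have : Epi ((locUnit S).app N) := hN
  change Epi _
  rw [Preadditive.epi_iff_cancel_zero]
  intro W g hg
  have h₁ : (locFunctor S).map (biprod.inl : M ⟶ M ⊞ N) ≫ g = 0 := by
    rw [← cancel_epi ((locUnit S).app M), comp_zero, ← Category.assoc, ← (locUnit S).naturality,
      Category.assoc, hg, comp_zero]
  have h₂ : (locFunctor S).map (biprod.inr : N ⟶ M ⊞ N) ≫ g = 0 := by
    rw [← cancel_epi ((locUnit S).app N), comp_zero, ← Category.assoc, ← (locUnit S).naturality,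
      Category.assoc, hg, comp_zero]
  rw [← Category.id_comp g, ← CategoryTheory.Functor.map_id, ← biprod.total, Functor.map_add,
    Functor.map_comp, Functor.map_comp, Preadditive.add_comp, Category.assoc, Category.assoc,
    h₁, h₂, comp_zero, comp_zero, add_zero]

variable {S}

/-- To reach `x / s`, extend the map `a (s r) ↦ a r x` from the ideal `(s r)` to `R` by injectivity
and evaluate at `1`. The map is well defined: `a s r = 0` makes `a` a torsion element, so `r a = 0`
by the bound on torsion. -/
lemma isAdjusted_of_injective (hS : HasBoundedTorsion S) (J : ModuleCat.{u} R) [Injective J] :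
    isAdjusted S J := by
  obtain ⟨r, hr, hrS⟩ := hS
  refine (ModuleCat.epi_iff_surjective _).2 fun y => ?_
  obtain ⟨s, hs, x, hx⟩ := exists_smul_eq_locUnit_app y
  have hann (a : R) (ha : a * (s * r) = 0) : a • (r • x) = 0 := by
    have := hrS a ⟨s * r, S.mul_mem hs hr, by rw [mul_comm, ha]⟩
    rw [smul_smul, mul_comm, this, zero_smul]
  let K := LinearMap.ker (LinearMap.toSpanSingleton R R (s * r))
  let i : ModuleCat.of R (R ⧸ K) ⟶ ModuleCat.of R R := ModuleCat.ofHom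
    (K.liftQ (LinearMap.toSpanSingleton R R (s * r)) le_rfl)
  let φ : ModuleCat.of R (R ⧸ K) ⟶ J := ModuleCat.ofHom
    (K.liftQ (LinearMap.toSpanSingleton R J (r • x)) fun a ha => hann a ha)
  have : Mono i := (ModuleCat.mono_iff_injective _).2
    (LinearMap.ker_eq_bot.1 (Submodule.ker_liftQ_eq_bot _ _ _ le_rfl))
  let h : ModuleCat.of R R ⟶ J := Injective.factorThru φ i
  have hh : (s * r) • h (1 : R) = r • x := by
    have e₁ : i (Submodule.Quotient.mk (1 : R)) = (s * r) • (1 : R) := by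
      refine (Submodule.liftQ_apply ..).trans ?_
      simp
    have e₂ : φ (Submodule.Quotient.mk (1 : R)) = r • x := by
      refine (Submodule.liftQ_apply ..).trans ?_
      simp
    have e₃ : h (i (Submodule.Quotient.mk (1 : R))) = φ (Submodule.Quotient.mk (1 : R)) :=
      ConcreteCategory.congr_hom (Injective.comp_factorThru φ i) _
    rw [← e₂, ← e₃, e₁]
    exact (map_smul h.hom _ _).symm
  refine ⟨h (1 : R), (isSInvertible_restrictScalars _ _ (S.mul_mem hs hr)).1 ?_⟩
  refine (map_smul ((locUnit S).app J).hom (s * r) (h (1 : R))).symm.trans ?_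
  rw [hh, map_smul, mul_comm]
  exact (congrArg (r • ·) hx.symm).trans (mul_smul r s y).symm

lemma exists_mono_isAdjusted (hS : HasBoundedTorsion S) (M : ModuleCat.{u} R) :
    ∃ (N : ModuleCat.{u} R) (e : M ⟶ N), Mono e ∧ isAdjusted S N :=
  ⟨_, Injective.ι M, inferInstance, isAdjusted_of_injective hS _⟩

lemma exists_quasiIso_isAdjusted (hS : HasBoundedTorsion S)
    (X : CochainComplex (ModuleCat.{u} R) ℤ) :
    ∃ (Y : CochainComplex (ModuleCat.{u} R) ℤ) (s : X ⟶ Y), QuasiIso s ∧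
      ∀ n, isAdjusted S (Y.X n) :=
  exists_quasiIso_to _ (isAdjusted_biprod S) (fun f _ h => isAdjusted_of_epi S f h)
    (exists_mono_isAdjusted hS) X

end Torsion

section ShortExact

open DerivedCategory

variable {A : Type u} [Category.{v} A] [Abelian A] [HasDerivedCategory.{w} A]
  (P : ObjectProperty (DerivedCategory A)) [P.IsTriangulated] [P.IsClosedUnderIsomorphisms]
  {T : ShortComplex (CochainComplex A ℤ)} (hT : T.ShortExact)

include hT

omit [P.IsTriangulated] [P.IsClosedUnderIsomorphisms] in
lemma trW_Q_map_f (h : P (Q.obj T.X₃)) : P.trW (Q.map T.f) :=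
  .mk P (triangleOfSES_distinguished hT) h

lemma trW_Q_map_g (h : P (Q.obj T.X₁)) : P.trW (Q.map T.g) :=
  (P.trW_iff_of_distinguished' _ (triangleOfSES_distinguished hT)).2 h

lemma isIso_Q_map_f (h : IsZero (Q.obj T.X₃)) : IsIso (Q.map T.f) :=
  (Triangle.isZero₃_iff_isIso₁ _ (triangleOfSES_distinguished hT)).1 h

lemma prop_Q_obj_X₁ (h₂ : P (Q.obj T.X₂)) (h₃ : P (Q.obj T.X₃)) : P (Q.obj T.X₁) :=
  P.ext_of_isTriangulatedClosed₁ _ (triangleOfSES_distinguished hT) h₂ h₃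

lemma prop_Q_obj_X₃ (h₁ : P (Q.obj T.X₁)) (h₂ : P (Q.obj T.X₂)) : P (Q.obj T.X₃) :=
  P.ext_of_isTriangulatedClosed₃ _ (triangleOfSES_distinguished hT) h₁ h₂

end ShortExact

/-! ### The torsion complexes as a left complement. -/

section Torsion

open DerivedCategory

variable {R : Type u} [CommRing R] (S : Submonoid R)

/-- The morphism of complexes `Z → S⁻¹Z`. -/
noncomputable abbrev locUnitComplex (Z : CochainComplex (ModuleCat.{u} R) ℤ) :
    Z ⟶ ((locFunctor S).mapHomologicalComplex (.up ℤ)).obj Z :=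
  (NatTrans.mapHomologicalComplex (locUnit S) (.up ℤ)).app Z

/-- Termwise, the kernel of `Z → S⁻¹Z` consists of torsion modules. -/
lemma exists_torsionPart (Z : CochainComplex (ModuleCat.{u} R) ℤ) :
    ∃ (T : CochainComplex (STors S) ℤ)
      (k : ((isSTorsion S).ι.mapHomologicalComplex (.up ℤ)).obj T ⟶ Z)
      (w : k ≫ locUnitComplex S Z = 0), Mono k ∧
      (ShortComplex.mk k (locUnitComplex S Z) w).Exact := by
  refine ⟨HomologicalComplex.liftObjectProperty (isSTorsion S) (kernel (locUnitComplex S Z))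
    fun n x => ?_, kernel.ι _, kernel.condition _,
    (inferInstance : Mono (kernel.ι (locUnitComplex S Z))),
    ShortComplex.exact_of_f_is_kernel _ (kernelIsKernel _)⟩
  have h : (locUnit S).app (Z.X n) ((kernel.ι (locUnitComplex S Z)).f n x) = 0 := by
    have := congrArg (fun f => f.f n x) (kernel.condition (locUnitComplex S Z))
    exact this
  obtain ⟨s, hs, h⟩ := locUnit_app_eq_zero_iff.1 h
  refine ⟨s, hs, (ModuleCat.mono_iff_injective ((kernel.ι (locUnitComplex S Z)).f n)).1
    inferInstance ?_⟩
  rw [map_smul, h, map_zero]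

variable {S} in
lemma comp_locUnit_app_eq_zero {M N : ModuleCat.{u} R} (hM : isSTorsion S M) (g : M ⟶ N) :
    g ≫ (locUnit S).app N = 0 := by
  refine ((locUnit S).naturality g).trans ?_
  rw [(isZero_locFunctor_obj hM).eq_of_src ((locFunctor S).map g) 0, comp_zero]

lemma comp_locUnitComplex_eq_zero {M : CochainComplex (STors S) ℤ}
    {Z : CochainComplex (ModuleCat.{u} R) ℤ}
    (g : ((isSTorsion S).ι.mapHomologicalComplex (.up ℤ)).obj M ⟶ Z) :
    g ≫ locUnitComplex S Z = 0 := by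
  ext1 n
  exact comp_locUnit_app_eq_zero (M.X n).property (g.f n)

variable [HasDerivedCategory.{w} (ModuleCat.{u} R)]

lemma isZero_Q_obj_loc (M : CochainComplex (STors S) ℤ) :
    IsZero (Q.obj (((locFunctor S).mapHomologicalComplex (.up ℤ)).obj
      (((isSTorsion S).ι.mapHomologicalComplex (.up ℤ)).obj M))) := by
  refine Q.map_isZero ?_
  rw [IsZero.iff_id_eq_zero]
  ext1 n
  exact (isZero_locFunctor_obj (M.X n).property).eq_of_src _ _

/-- In a roof `M → Z ← N`, enlarge `Z` to an adjusted `Z'`. Both maps factor through the torsion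
part `T` of `Z'`, and `T → Z'` is a quasi-isomorphism since its cone `S⁻¹Z'` is quasi-isomorphic to
`S⁻¹N = 0`. -/
lemma full_mapDerivedCategory_torsion (hS : HasBoundedTorsion S)
    [HasDerivedCategory.{w₁} (STors S)] : (isSTorsion S).ι.mapDerivedCategory.Full := by
  refine full_mapDerivedCategory_of_left_fac _ fun M N f => ?_
  obtain ⟨Z, g, s, hs, rfl⟩ := left_fac f
  obtain ⟨Z', t, ht, hZ'⟩ := exists_quasiIso_isAdjusted hS Z
  rw [← isIso_Q_map_iff_quasiIso] at ht
  obtain ⟨T, k, w, hk, hT⟩ := exists_torsionPart S Z'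
  have : Epi (locUnitComplex S Z') := HomologicalComplex.epi_of_epi_f _ hZ'
  have hT : (ShortComplex.mk k (locUnitComplex S Z') w).ShortExact := ⟨hT⟩
  have hst : IsIso (Q.map (s ≫ t)) := by
    rw [Q.map_comp]
    infer_instance
  have hk' : IsIso (Q.map k) := isIso_Q_map_f hT <| by
    have : IsIso (Q.map (((locFunctor S).mapHomologicalComplex (.up ℤ)).map (s ≫ t))) := by
      rw [isIso_Q_map_iff_quasiIso] at hst ⊢
      infer_instance
    exact (isZero_Q_obj_loc S N).of_iso (asIso (Q.map
      (((locFunctor S).mapHomologicalComplex (.up ℤ)).map (s ≫ t)))).symm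
  obtain ⟨g', hg'⟩ := exists_lift_hom
    (hT.exact.lift (g ≫ t) (comp_locUnitComplex_eq_zero S (g ≫ t)))
  obtain ⟨s', hs'⟩ := exists_lift_hom
    (hT.exact.lift (s ≫ t) (comp_locUnitComplex_eq_zero S (s ≫ t)))
  have hgk : ((isSTorsion S).ι.mapHomologicalComplex (.up ℤ)).map g' ≫ k = g ≫ t := by
    rw [hg']
    exact hT.exact.lift_f _ _
  have hsk : ((isSTorsion S).ι.mapHomologicalComplex (.up ℤ)).map s' ≫ k = s ≫ t := by
    rw [hs']
    exact hT.exact.lift_f _ _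
  refine ⟨T, g', s', ?_, ?_⟩
  · have : IsIso (Q.map (((isSTorsion S).ι.mapHomologicalComplex (.up ℤ)).map s') ≫ Q.map k) := by
      rw [← Q.map_comp, hsk]
      exact hst
    exact IsIso.of_isIso_comp_right _ (Q.map k)
  · rw [← cancel_mono (Q.map k), Category.assoc, ← Q.map_comp, ← Q.map_comp, hsk, hgk]
    simp

/-- A target with invertible `S`-action is quasi-isomorphic to its localization, where every chain
map from a torsion complex vanishes. -/
lemma leftOrthogonal_torsion [HasDerivedCategory.{w₁} (STors S)] (M : DerivedCategory (STors S)) :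
    (sInvertible S).leftOrthogonal ((isSTorsion S).ι.mapDerivedCategory.obj M) := by
  intro Z f hZ
  let eM := Q.objObjPreimageIso M
  let e := (isSTorsion S).ι.mapDerivedCategory.mapIso eM.symm ≪≫
    (isSTorsion S).ι.mapDerivedCategoryFactors.app _
  let eZ := Q.objObjPreimageIso Z
  rw [← cancel_epi e.inv, ← cancel_mono eZ.inv, comp_zero, zero_comp]
  generalize (e.inv ≫ f) ≫ eZ.inv = f'
  obtain ⟨K, g, s, hs, rfl⟩ := left_fac f'
  have hK : sInvertible S (Q.obj K) :=
    (sInvertible S).prop_of_iso (eZ.symm ≪≫ asIso (Q.map s)) hZ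
  have := quasiIso_locUnit hK
  rw [← isIso_Q_map_iff_quasiIso] at this
  have h : Q.map g = 0 := by
    have : Mono (Q.map (locUnitComplex S K)) := @IsIso.mono_of_iso _ _ _ _ _ this
    rw [← cancel_mono (Q.map (locUnitComplex S K)), ← Q.map_comp, comp_locUnitComplex_eq_zero,
      Q.map_zero, zero_comp]
  rw [h, zero_comp]

lemma property_Q_obj_map (star : DerivedSymbol) {Y : CochainComplex (ModuleCat.{u} R) ℤ}
    (F : ModuleCat.{u} R ⥤ ModuleCat.{u} R) [F.Additive] [PreservesFiniteLimits F]
    [PreservesFiniteColimits F] (hY : star.property _ (Q.obj Y)) :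
    star.property _ (Q.obj ((F.mapHomologicalComplex (.up ℤ)).obj Y)) :=
  ObjectProperty.prop_of_iso _ (F.mapDerivedCategoryFactors.app Y)
    (property_mapDerivedCategory F star hY)

lemma exists_trW_from_torsion (hS : HasBoundedTorsion S) [HasDerivedCategory.{w₁} (STors S)]
    (star : DerivedSymbol) (X : DStar (ModuleCat.{u} R) star) :
    ∃ (M : DStar (STors S) star) (t : (mapDStar (isSTorsion S).ι star).obj M ⟶ X),
      (sInvertible S).trW t.hom := by
  let e := Q.objObjPreimageIso X.obj
  obtain ⟨Y, s, hs, hY⟩ := exists_quasiIso_isAdjusted hS (Q.objPreimage X.obj)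
  rw [← isIso_Q_map_iff_quasiIso] at hs
  have hY' : star.property _ (Q.obj Y) :=
    ObjectProperty.prop_of_iso _ (e.symm ≪≫ asIso (Q.map s)) X.property
  obtain ⟨T, k, w, hk, hT⟩ := exists_torsionPart S Y
  have : Epi (locUnitComplex S Y) := HomologicalComplex.epi_of_epi_f _ hY
  have hT : (ShortComplex.mk k (locUnitComplex S Y) w).ShortExact := ⟨hT⟩
  have hk' : (sInvertible S).trW (Q.map k) := trW_Q_map_f _ hT
    (sInvertible_Q_obj fun n => isSInvertible_restrictScalars _)
  let eT : (isSTorsion S).ι.mapDerivedCategory.obj (Q.obj T) ≅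
      Q.obj (((isSTorsion S).ι.mapHomologicalComplex (.up ℤ)).obj T) :=
    (isSTorsion S).ι.mapDerivedCategoryFactors.app T
  -- `T` is the fibre of `Y → S⁻¹Y`, and localization, being exact, preserves each boundedness
  -- condition.
  have h : star.property _ ((isSTorsion S).ι.mapDerivedCategory.obj (Q.obj T)) :=
    ObjectProperty.prop_of_iso _ eT.symm
      (prop_Q_obj_X₁ _ hT hY' (property_Q_obj_map star _ hY'))
  refine ⟨⟨Q.obj T, property_of_property_mapDerivedCategory _ star h⟩,
    ObjectProperty.homMk (eT.hom ≫ Q.map k ≫ inv (Q.map s) ≫ e.hom), ?_⟩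
  have ht := (MorphismProperty.cancel_left_of_respectsIso (sInvertible S).trW eT.hom _).2
    ((MorphismProperty.cancel_right_of_respectsIso _ _ (inv (Q.map s) ≫ e.hom)).2 hk')
  exact ht

end Torsion

/-! ### Factorizations of linear maps. -/

section LinearMaps

variable {R : Type*} [CommRing R] {M N P A E D : Type*} [AddCommGroup M] [Module R M]
  [AddCommGroup N] [Module R N] [AddCommGroup P] [Module R P] [AddCommGroup A] [Module R A]
  [AddCommGroup E] [Module R E] [AddCommGroup D] [Module R D]

lemma exists_comp_eq_of_ker_le {f : M →ₗ[R] N} (hf : Function.Surjective f) {g : M →ₗ[R] P}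
    (h : ∀ x, f x = 0 → g x = 0) : ∃ k : N →ₗ[R] P, k ∘ₗ f = g := by
  refine ⟨(LinearMap.ker f).liftQ g (fun x hx => h x hx) ∘ₗ
    (f.quotKerEquivOfSurjective hf).symm.toLinearMap, ?_⟩
  ext x
  have : (f.quotKerEquivOfSurjective hf).symm (f x) = Submodule.Quotient.mk x := by
    rw [LinearEquiv.symm_apply_eq]
    rfl
  simp only [LinearMap.comp_apply, LinearEquiv.coe_coe, this]
  exact (LinearMap.ker f).liftQ_apply g x

/-- A factorization through a submodule given as the range of an injective map. -/
lemma exists_comp_eq_of_range_le {j : A →ₗ[R] E} (hj : Function.Injective j) {g : P →ₗ[R] E}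
    (h : ∀ x, ∃ a, j a = g x) : ∃ k : P →ₗ[R] A, j ∘ₗ k = g := by
  refine ⟨(LinearEquiv.ofInjective j hj).symm.toLinearMap ∘ₗ
    g.codRestrict (LinearMap.range j) h, ?_⟩
  ext x
  have := (LinearEquiv.ofInjective j hj).apply_symm_apply
    (g.codRestrict (LinearMap.range j) h x)
  exact congrArg Subtype.val this

lemma exists_retraction_of_exact {j : A →ₗ[R] E} {θ : E →ₗ[R] D} [Module.Projective R D]
    (hj : Function.Injective j) (hθ : Function.Surjective θ) (h : Function.Exact j θ) :
    ∃ ρ : E →ₗ[R] A, ρ ∘ₗ j = LinearMap.id := by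
  obtain ⟨σ, hσ⟩ := Module.projective_lifting_property θ LinearMap.id hθ
  obtain ⟨ρ, hρ⟩ := exists_comp_eq_of_range_le hj (g := LinearMap.id - σ ∘ₗ θ) fun x => by
    refine (h _).1 ?_
    have : θ (σ (θ x)) = θ x := LinearMap.congr_fun hσ (θ x)
    simp [this]
  refine ⟨ρ, LinearMap.ext fun a => hj ?_⟩
  have : j (ρ (j a)) = j a - σ (θ (j a)) := LinearMap.congr_fun hρ (j a)
  rw [h.apply_apply_eq_zero, map_zero, sub_zero] at this
  exact this

/-- Lifting a map from a projective module along an exact sequence. -/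
lemma exists_comp_eq_of_exact [Module.Projective R P] {f : A →ₗ[R] E} {g : E →ₗ[R] D}
    (h : Function.Exact f g) (k : P →ₗ[R] E) (hk : g ∘ₗ k = 0) : ∃ k' : P →ₗ[R] A, f ∘ₗ k' = k := by
  obtain ⟨k', hk'⟩ := Module.projective_lifting_property f.rangeRestrict
    (k.codRestrict (LinearMap.range f) fun x => (h _).1 (LinearMap.congr_fun hk x))
    f.surjective_rangeRestrict
  exact ⟨k', LinearMap.ext fun x => congrArg Subtype.val (LinearMap.congr_fun hk' x)⟩

end LinearMaps

/-! ### A projective model `L = R ⊕ P₁ → P₀` of `R → S⁻¹R`. -/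

section Presentation

variable {R : Type u} [CommRing R] (S : Submonoid R)

/-- The free module on the elements of `S⁻¹R`. -/
abbrev FreeCover := Localization S →₀ R

/-- The projection of the free module on the elements of `S⁻¹R` onto `S⁻¹R`. -/
noncomputable def cover : FreeCover S →ₗ[R] Localization S := Finsupp.linearCombination R id

/-- The kernel of the projection of a free module onto `S⁻¹R`. -/
noncomputable abbrev Syzygy := LinearMap.ker (cover S)

/-- The lift of `1 : S⁻¹R` to the free cover. -/
noncomputable def coverOne : FreeCover S := Finsupp.single 1 1

@[simp]
lemma cover_coverOne : cover S (coverOne S) = 1 := by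
  simp [cover, coverOne]

lemma cover_surjective : Function.Surjective (cover S) := fun x =>
  ⟨Finsupp.single x 1, by simp [cover]⟩

/-- The map `R ⊕ P₁ → P₀` lifting the map `R → S⁻¹R` to the projective presentation
`P₁ → P₀` of `S⁻¹R`. -/
noncomputable def relMap : R × Syzygy S →ₗ[R] FreeCover S :=
  (LinearMap.toSpanSingleton R _ (coverOne S)).coprod (Syzygy S).subtype

@[simp]
lemma relMap_apply (x : R × Syzygy S) : relMap S x = x.1 • coverOne S + x.2 := rfl

lemma cover_syzygy (x : Syzygy S) : cover S x = 0 := x.2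

variable {S}

/-- The kernel and, by the next lemma, the cokernel of `relMap` are `S`-torsion, as they are for `R
→ S⁻¹R`; localization therefore turns `relMap` into an isomorphism. -/
lemma exists_smul_eq_zero_of_relMap {x : R × Syzygy S} (hx : relMap S x = 0) :
    ∃ c ∈ S, c • x = 0 := by
  have h : algebraMap R (Localization S) x.1 = 0 := by
    have := congrArg (cover S) hx
    simpa [cover_syzygy, Algebra.smul_def] using this
  obtain ⟨⟨c, hc⟩, h⟩ := (IsLocalization.map_eq_zero_iff S (Localization S) x.1).1 h
  refine ⟨c, hc, Prod.ext h ?_⟩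
  ext1
  have := congrArg (c • ·) hx
  simp only [relMap_apply, smul_add, smul_smul, h, zero_smul, zero_add, smul_zero] at this
  exact this

lemma exists_smul_eq_relMap (y : FreeCover S) : ∃ c ∈ S, ∃ x, relMap S x = c • y := by
  obtain ⟨⟨a, c⟩, h⟩ := IsLocalization.surj S (cover S y)
  refine ⟨c, c.2, ⟨a, c • y - a • coverOne S, ?_⟩, ?_⟩
  · have : (c : R) • cover S y = algebraMap R _ a := by
      rw [Algebra.smul_def, mul_comm, ← h]
    rw [LinearMap.mem_ker, map_sub, Submonoid.smul_def, map_smul, this, map_smul, cover_coverOne,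
      Algebra.algebraMap_eq_smul_one, sub_self]
  · simp [Submonoid.smul_def]

end Presentation

section Tensor

open TensorProduct

variable {R : Type*} [CommRing R] {S : Submonoid R}

lemma lTensor_bijective_of_torsion {L P : Type v} [AddCommGroup L] [Module R L] [AddCommGroup P]
    [Module R P] (l : L →ₗ[R] P) (h₀ : ∀ x, l x = 0 → ∃ c ∈ S, c • x = 0)
    (h₁ : ∀ y, ∃ c ∈ S, ∃ x, l x = c • y) :
    Function.Bijective (l.lTensor (Localization S)) := by
  have hb (M : Type v) [AddCommGroup M] [Module R M] (s : R) (hs : s ∈ S) :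
      Function.Bijective (fun z : Localization S ⊗[R] M => s • z) := by
    exact (Module.End.isUnit_iff _).1
      (IsLocalizedModule.map_units (TensorProduct.mk R (Localization S) M 1) ⟨s, hs⟩)
  constructor
  · refine (injective_iff_map_eq_zero _).2 fun z hz => ?_
    obtain ⟨⟨x, s⟩, h⟩ := IsLocalizedModule.surj S (TensorProduct.mk R (Localization S) L 1) z
    have hx : TensorProduct.mk R (Localization S) P 1 (l x) = 0 := by
      have := congrArg (l.lTensor (Localization S)) h
      rw [Submonoid.smul_def, map_smul, hz, smul_zero] at this
      simpa using this.symm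
    obtain ⟨⟨c, hc⟩, hx⟩ := (IsLocalizedModule.eq_zero_iff S _).1 hx
    obtain ⟨c', hc', hx'⟩ := h₀ (c • x) (by rwa [map_smul])
    refine (hb _ (c' * c * s) (S.mul_mem (S.mul_mem hc' hc) s.2)).1 ?_
    simp only [smul_zero]
    rw [mul_smul, ← Submonoid.smul_def s, h, ← map_smul, mul_smul, hx', map_zero]
  · intro w
    obtain ⟨⟨y, s⟩, h⟩ := IsLocalizedModule.surj S (TensorProduct.mk R (Localization S) P 1) w
    obtain ⟨c, hc, x, hx⟩ := h₁ y
    obtain ⟨z, hz⟩ := (hb _ (c * s) (S.mul_mem hc s.2)).2 (1 ⊗ₜ x)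
    refine ⟨z, (hb _ (c * s) (S.mul_mem hc s.2)).1 ?_⟩
    simp only at hz ⊢
    rw [← map_smul, hz, LinearMap.lTensor_tmul, hx, mul_smul, ← Submonoid.smul_def s, h]
    simp

end Tensor

/-! ### The total complex of `(P₁ → P₀) ⊗ (L → P₀)`. -/

section Bicomplex

open TensorProduct

variable {R : Type*} [CommRing R] {P₀ P₁ L Q M : Type*} [AddCommGroup P₀] [Module R P₀]
  [AddCommGroup P₁] [Module R P₁] [AddCommGroup L] [Module R L] [AddCommGroup Q] [Module R Q]
  [AddCommGroup M] [Module R M] (d : P₁ →ₗ[R] P₀) (l : L →ₗ[R] P₀) {π : P₀ →ₗ[R] Q}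

/-- The map `P₁ ⊗ L → (P₀ ⊗ L) ⊕ (P₁ ⊗ P₀)`. -/
noncomputable def tensorIn : P₁ ⊗[R] L →ₗ[R] (P₀ ⊗[R] L) × (P₁ ⊗[R] P₀) :=
  (d.rTensor L).prod (-(l.lTensor P₁))

/-- The map `(P₀ ⊗ L) ⊕ (P₁ ⊗ P₀) → P₀ ⊗ P₀`. -/
noncomputable def tensorOut : (P₀ ⊗[R] L) × (P₁ ⊗[R] P₀) →ₗ[R] P₀ ⊗[R] P₀ :=
  (l.lTensor P₀).coprod (d.rTensor P₀)

@[simp]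
lemma tensorIn_apply (a : P₁ ⊗[R] L) : tensorIn d l a = (d.rTensor L a, -(l.lTensor P₁ a)) := rfl

@[simp]
lemma tensorOut_apply (b : P₀ ⊗[R] L) (c : P₁ ⊗[R] P₀) :
    tensorOut d l (b, c) = l.lTensor P₀ b + d.rTensor P₀ c := rfl

lemma rTensor_lTensor_apply {A B C D : Type*} [AddCommGroup A] [Module R A] [AddCommGroup B]
    [Module R B] [AddCommGroup C] [Module R C] [AddCommGroup D] [Module R D]
    (f : A →ₗ[R] B) (g : C →ₗ[R] D) (x : A ⊗[R] C) :
    f.rTensor D (g.lTensor A x) = g.lTensor B (f.rTensor C x) := by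
  rw [← LinearMap.comp_apply, LinearMap.rTensor_comp_lTensor, ← LinearMap.lTensor_comp_rTensor,
    LinearMap.comp_apply]

variable {d l} (hπ : Function.Surjective π) (he : Function.Exact d π)
  (hl : Function.Bijective (l.lTensor Q))

include hπ he hl

/-- `tensorIn` and `tensorOut` form a total complex. As `P₁ → P₀` resolves `Q` and `Q ⊗ L → Q ⊗ P₀`
is invertible, this complex is acyclic; the next lemmas complete the short exact sequence. -/
lemma tensorOut_surjective : Function.Surjective (tensorOut d l) := fun x => by
  obtain ⟨z, hz⟩ := hl.2 (π.rTensor _ x)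
  obtain ⟨b, rfl⟩ := LinearMap.rTensor_surjective _ hπ z
  obtain ⟨c, hc⟩ := (rTensor_exact _ he hπ (x - l.lTensor _ b)).1 (by
    rw [map_sub, rTensor_lTensor_apply, hz, sub_self])
  exact ⟨(b, c), by simp [hc]⟩

variable (hd : Function.Injective d)

include hd

omit hπ hl he in
lemma tensorIn_injective [Module.Flat R L] : Function.Injective (tensorIn d l) := fun _ _ h =>
  Module.Flat.rTensor_preserves_injective_linearMap _ hd (congrArg Prod.fst h)

lemma tensor_exact [Module.Flat R P₀] : Function.Exact (tensorIn d l) (tensorOut d l) := by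
  have heL := rTensor_exact L he hπ
  have heP := rTensor_exact P₀ he hπ
  rintro ⟨b, c⟩
  constructor
  · intro h
    rw [tensorOut_apply] at h
    have hb : π.rTensor _ b = 0 := by
      refine hl.1 ?_
      have := congrArg (π.rTensor _) h
      rw [map_add, heP.apply_apply_eq_zero, add_zero, map_zero, rTensor_lTensor_apply] at this
      rw [this, map_zero]
    obtain ⟨a, rfl⟩ := (heL b).1 hb
    refine ⟨a, Prod.ext rfl (Module.Flat.rTensor_preserves_injective_linearMap _ hd ?_)⟩
    have := eq_neg_of_add_eq_zero_right h
    rw [this, tensorIn_apply, map_neg, rTensor_lTensor_apply]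
  · rintro ⟨a, h⟩
    rw [← h, tensorIn_apply, tensorOut_apply, map_neg, rTensor_lTensor_apply, add_neg_cancel]

/-- `P₀ ⊗ P₀` is the cokernel of `tensorIn`, and agreement of `H` and `K` on `P₁ ⊗ L` is exactly the
condition for gluing them. -/
lemma exists_bilinear_eq [Module.Flat R P₀] (H : P₀ →ₗ[R] L →ₗ[R] M) (K : P₁ →ₗ[R] P₀ →ₗ[R] M)
    (h : ∀ p x, K p (l x) = H (d p) x) :
    ∃ G : P₀ →ₗ[R] P₀ →ₗ[R] M, ∀ p x, G p (l x) = H p x := by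
  obtain ⟨G, hG⟩ := exists_comp_eq_of_ker_le (tensorOut_surjective hπ he hl)
    (g := (TensorProduct.lift H).coprod (TensorProduct.lift K)) fun y hy => by
      obtain ⟨a, rfl⟩ := (tensor_exact hπ he hl hd y).1 hy
      have : TensorProduct.lift K ∘ₗ l.lTensor _ = TensorProduct.lift H ∘ₗ d.rTensor _ :=
        TensorProduct.ext' h
      have : TensorProduct.lift K (l.lTensor _ a) = TensorProduct.lift H (d.rTensor _ a) :=
        LinearMap.congr_fun this a
      rw [tensorIn_apply, LinearMap.coprod_apply, map_neg, this, add_neg_cancel]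
  refine ⟨TensorProduct.curry G, fun p x => ?_⟩
  simpa using LinearMap.congr_fun hG (p ⊗ₜ x, 0)

/-- Projectivity of `P₀ ⊗ P₀` splits the exact sequence, so `G` extends along `tensorIn`. The minus
sign in `tensorIn` is absorbed into `K`. -/
lemma exists_bilinear_add_eq [Module.Projective R P₀] [Module.Flat R L]
    (G : P₁ →ₗ[R] L →ₗ[R] M) :
    ∃ (H : P₀ →ₗ[R] L →ₗ[R] M) (K : P₁ →ₗ[R] P₀ →ₗ[R] M),
      ∀ p x, H (d p) x + K p (l x) = G p x := by
  obtain ⟨ρ, hρ⟩ := exists_retraction_of_exact (tensorIn_injective hd)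
    (tensorOut_surjective hπ he hl) (tensor_exact hπ he hl hd)
  let Γ := TensorProduct.lift G ∘ₗ ρ
  refine ⟨TensorProduct.curry (Γ ∘ₗ LinearMap.inl _ _ _),
    - TensorProduct.curry (Γ ∘ₗ LinearMap.inr _ _ _), fun p x => ?_⟩
  have h : Γ (d p ⊗ₜ x, -(p ⊗ₜ l x)) = G p x := by
    have := congrArg (TensorProduct.lift G) (LinearMap.congr_fun hρ (p ⊗ₜ x))
    simpa [Γ] using this
  rw [← h, show ((d p ⊗ₜ[R] x, -(p ⊗ₜ l x)) : (P₀ ⊗[R] L) × (P₁ ⊗[R] P₀)) =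
    (d p ⊗ₜ x, 0) - (0, p ⊗ₜ l x) by simp, map_sub, sub_eq_add_neg]
  rfl

end Bicomplex

/-! ### The exact functors `Hom_R(P, -)` for projective `P`. -/

section HomFunctor

variable {R : Type u} [CommRing R] (P P' : Type u) [AddCommGroup P] [Module R P]
  [AddCommGroup P'] [Module R P']

/-- The functor `M ↦ Hom_R(P, M)` on `R`-modules. -/
def homFunctor : ModuleCat.{u} R ⥤ ModuleCat.{u} R where
  obj M := ModuleCat.of R (P →ₗ[R] M)
  map f := ModuleCat.ofHom (LinearMap.compRight R f.hom)

variable {P P'} in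
/-- The natural transformation `Hom_R(P', -) ⟶ Hom_R(P, -)` induced by a linear map `P → P'`. -/
def homFunctorMap (f : P →ₗ[R] P') : homFunctor (R := R) P' ⟶ homFunctor P where
  app M := ModuleCat.ofHom (LinearMap.lcomp R M f)

instance : (homFunctor (R := R) P).Additive where
  map_add {M N f g} := by
    ext φ
    exact LinearMap.ext fun x => rfl

variable [Module.Projective R P]

lemma shortExact_map_homFunctor {T : ShortComplex (ModuleCat.{u} R)} (hT : T.ShortExact) :
    (T.map (homFunctor P)).ShortExact where
  exact := by
    rw [ShortComplex.ShortExact.moduleCat_exact_iff_function_exact]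
    have h := (ShortComplex.ShortExact.moduleCat_exact_iff_function_exact T).1 hT.exact
    intro φ
    constructor
    · intro hφ
      exact exists_comp_eq_of_exact (f := T.f.hom) (g := T.g.hom) h φ hφ
    · rintro ⟨ψ, rfl⟩
      exact LinearMap.ext fun x => h.apply_apply_eq_zero ((show P →ₗ[R] T.X₁ from ψ) x)
  mono_f := by
    have := (ModuleCat.mono_iff_injective T.f).1 hT.mono_f
    exact (ModuleCat.mono_iff_injective _).2 fun φ ψ h =>
      LinearMap.ext fun x => this (LinearMap.congr_fun h x)
  epi_g := by
    have := (ModuleCat.epi_iff_surjective T.g).1 hT.epi_g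
    exact (ModuleCat.epi_iff_surjective _).2 fun φ =>
      Module.projective_lifting_property T.g.hom φ this

lemma homFunctor_preservesFinite :
    PreservesFiniteLimits (homFunctor (R := R) P) ∧ PreservesFiniteColimits (homFunctor (R := R) P) :=
  ((Functor.exact_tfae (homFunctor (R := R) P)).out 0 3).1 fun _ => shortExact_map_homFunctor P

instance : PreservesFiniteLimits (homFunctor (R := R) P) := (homFunctor_preservesFinite P).1

instance : PreservesFiniteColimits (homFunctor (R := R) P) := (homFunctor_preservesFinite P).2

end HomFunctor

/-! ### Contramodules and coadjusted modules through the presentation. -/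

section Contramodule

variable {R : Type u} [CommRing R] (S : Submonoid R)

/-- The presentation of `S⁻¹R` by its free cover. -/
noncomputable abbrev presentation : ShortComplex (ModuleCat.{u} R) where
  X₁ := ModuleCat.of R (Syzygy S)
  X₂ := ModuleCat.of R (FreeCover S)
  X₃ := localizationModule S
  f := ModuleCat.ofHom (Syzygy S).subtype
  g := ModuleCat.ofHom (cover S)
  zero := by
    ext x
    exact x.2

lemma presentation_shortExact : (presentation S).ShortExact where
  exact := (ShortComplex.ShortExact.moduleCat_exact_iff_function_exact _).2
    (LinearMap.exact_subtype_ker_map (cover S))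
  mono_f := (ModuleCat.mono_iff_injective _).2 (Syzygy S).injective_subtype
  epi_g := (ModuleCat.epi_iff_surjective _).2 (cover_surjective S)

instance : Projective (ModuleCat.of R (FreeCover S)) :=
  (IsProjective.iff_projective _).1 inferInstance

instance projective_syzygy [h : HasProjectiveDimensionLE (localizationModule S) 1] :
    Module.Projective R (Syzygy S) := by
  have : HasProjectiveDimensionLT (presentation S).X₁ 1 :=
    ((presentation_shortExact S).hasProjectiveDimensionLT_X₃_iff 0
      (inferInstanceAs (Projective (ModuleCat.of R (FreeCover S))))).1 h
  exact (IsProjective.iff_projective (R := R) (Syzygy S)).2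
    (projective_iff_hasProjectiveDimensionLT_one.2 this)

variable {S}

lemma eq_zero_of_isSContramodule {C : ModuleCat.{u} R} (hC : isSContramodule S C)
    (f : Localization S →ₗ[R] C) : f = 0 := by
  have := hC.1
  have h : (ModuleCat.ofHom f : localizationModule S ⟶ C) = 0 :=
    (Abelian.Ext.mk₀_bijective _ _).1 (Subsingleton.elim _ _)
  exact congrArg ModuleCat.Hom.hom h

/-- A module `C` is an `S`-contramodule if and only if `Hom_R(P₀, C) → Hom_R(P₁, C)` is
bijective, for the presentation `P₁ → P₀` of `S⁻¹R`. -/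
lemma isSContramodule_iff {C : ModuleCat.{u} R} : isSContramodule S C ↔
    Function.Bijective (LinearMap.lcomp R C (Syzygy S).subtype) := by
  have hE := presentation_shortExact S
  constructor
  · intro hC
    constructor
    · refine (injective_iff_map_eq_zero _).2 fun f hf => ?_
      obtain ⟨k, rfl⟩ := exists_comp_eq_of_ker_le (cover_surjective S) (g := f)
        fun x hx => LinearMap.congr_fun hf ⟨x, hx⟩
      rw [eq_zero_of_isSContramodule hC k, LinearMap.zero_comp]
    · intro g
      have := hC.2
      obtain ⟨y, hy⟩ := Abelian.Ext.contravariant_sequence_exact₁ hE C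
        (Abelian.Ext.mk₀ (ModuleCat.ofHom g)) (add_zero 1) (Subsingleton.elim _ _)
      obtain ⟨f, rfl⟩ := (Abelian.Ext.mk₀_bijective _ _).2 y
      rw [Abelian.Ext.mk₀_comp_mk₀] at hy
      exact ⟨f.hom, congrArg ModuleCat.Hom.hom ((Abelian.Ext.mk₀_bijective _ _).1 hy)⟩
  · intro h
    refine ⟨subsingleton_of_forall_eq 0 fun x => ?_, subsingleton_of_forall_eq 0 fun x => ?_⟩
    · obtain ⟨f, rfl⟩ := (Abelian.Ext.mk₀_bijective _ _).2 x
      have hf : f.hom ∘ₗ cover S = 0 := h.1 (by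
        ext x
        simp)
      have hf : f = 0 := by
        ext x
        obtain ⟨y, rfl⟩ := cover_surjective S x
        exact LinearMap.congr_fun hf y
      rw [hf, Abelian.Ext.mk₀_zero]
    · have hP : Subsingleton (Abelian.Ext (presentation S).X₂ C 1) :=
        HasProjectiveDimensionLT.subsingleton (ModuleCat.of R (FreeCover S)) 1 1 le_rfl C
      obtain ⟨y, rfl⟩ := Abelian.Ext.contravariant_sequence_exact₃ hE C x
        (Subsingleton.elim _ _) (add_zero 1)
      obtain ⟨g, rfl⟩ := (Abelian.Ext.mk₀_bijective _ _).2 y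
      obtain ⟨f, hf⟩ := h.2 g.hom
      have hg : g = (presentation S).f ≫ ModuleCat.ofHom f := by
        ext x
        exact (LinearMap.congr_fun hf x).symm
      rw [hg, ← Abelian.Ext.mk₀_comp_mk₀, ShortComplex.ShortExact.extClass_comp_assoc]

variable (S) in
/-- The `R`-modules `M` such that the evaluation `Hom_R(S⁻¹R, M) → M` at `1` is injective. -/
def isCoadjusted : ObjectProperty (ModuleCat.{u} R) :=
  fun M => ∀ f : Localization S →ₗ[R] M, f 1 = 0 → f = 0

lemma isCoadjusted_of_isSContramodule {C : ModuleCat.{u} R} (hC : isSContramodule S C) :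
    isCoadjusted S C :=
  fun f _ => eq_zero_of_isSContramodule hC f

variable (S) in
lemma isCoadjusted_of_mono {M N : ModuleCat.{u} R} (f : M ⟶ N) [Mono f] (hN : isCoadjusted S N) :
    isCoadjusted S M := fun g hg => by
  have h := hN (f.hom ∘ₗ g) (by simp [hg])
  exact LinearMap.ext fun x => (ModuleCat.mono_iff_injective f).1 inferInstance
    ((LinearMap.congr_fun h x).trans (map_zero f.hom).symm)

instance : (isCoadjusted S).IsClosedUnderIsomorphisms where
  of_iso e h := isCoadjusted_of_mono S e.inv h

variable (S) in
lemma isCoadjusted_biprod (M N : ModuleCat.{u} R) (hM : isCoadjusted S M)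
    (hN : isCoadjusted S N) : isCoadjusted S (M ⊞ N) := fun f hf => by
  have h₁ : (biprod.fst : M ⊞ N ⟶ M).hom ∘ₗ f = 0 := hM _ (by simp [hf])
  have h₂ : (biprod.snd : M ⊞ N ⟶ N).hom ∘ₗ f = 0 := hN _ (by simp [hf])
  have : (ModuleCat.ofHom f : localizationModule S ⟶ M ⊞ N) = 0 := by
    apply biprod.hom_ext
    · rw [zero_comp]
      exact ModuleCat.hom_ext h₁
    · rw [zero_comp]
      exact ModuleCat.hom_ext h₂
  exact congrArg ModuleCat.Hom.hom this

/-- If `f 1 = 0`, each value of `f` is `S`-torsion, because every element of `S⁻¹R` has an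
`S`-multiple in `R · 1`. So the bound `r` kills `f`, and `f = 0` since `r` acts surjectively on
`S⁻¹R`. -/
lemma isCoadjusted_free (hS : HasBoundedTorsion S) (I : Type u) :
    isCoadjusted S (ModuleCat.of R (I →₀ R)) := fun f hf => by
  obtain ⟨r, hr, h⟩ := hS
  have hf' (x : Localization S) : ∃ s ∈ S, s • f x = 0 := by
    obtain ⟨⟨a, s⟩, hx⟩ := IsLocalization.surj S x
    have hx : (s : R) • x = a • (1 : Localization S) := by
      rw [Algebra.smul_def, mul_comm, hx, Algebra.algebraMap_eq_smul_one]
    exact ⟨s, s.2, by rw [← map_smul, hx, map_smul, hf, smul_zero]⟩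
  have hr' (x : Localization S) : r • f x = 0 := by
    obtain ⟨s, hs, hx⟩ := hf' x
    ext i
    exact h _ ⟨s, hs, DFunLike.congr_fun hx i⟩
  ext1 x
  obtain ⟨y, hy⟩ : ∃ y : Localization S, r • y = x := by
    have := IsLocalization.map_units (Localization S) (⟨r, hr⟩ : S)
    obtain ⟨y, hy⟩ := this.dvd (a := x)
    exact ⟨y, by rw [Algebra.smul_def, hy]⟩
  rw [← hy, map_smul, hr', LinearMap.zero_apply]

lemma exists_quasiIso_isCoadjusted (hS : HasBoundedTorsion S)
    (X : CochainComplex (ModuleCat.{u} R) ℤ) :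
    ∃ (Y : CochainComplex (ModuleCat.{u} R) ℤ) (s : Y ⟶ X), QuasiIso s ∧
      ∀ n, isCoadjusted S (Y.X n) :=
  exists_quasiIso_from _ (isCoadjusted_biprod S) (fun f _ h => isCoadjusted_of_mono S f h)
    (fun M => ⟨ModuleCat.of R (M →₀ R), ModuleCat.ofHom (Finsupp.linearCombination R id),
      (ModuleCat.epi_iff_surjective _).2 (fun x => ⟨Finsupp.single x 1, by simp⟩),
      isCoadjusted_free hS M⟩) X

/-- The kernel consists of the maps `S⁻¹R → M` vanishing at `1`. -/
lemma lcomp_relMap_injective {M : ModuleCat.{u} R} (hM : isCoadjusted S M) :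
    Function.Injective (LinearMap.lcomp R M (relMap S)) := by
  refine (injective_iff_map_eq_zero _).2 fun f hf => ?_
  have hf (x) : f (relMap S x) = 0 := LinearMap.congr_fun hf x
  obtain ⟨k, rfl⟩ := exists_comp_eq_of_ker_le (cover_surjective S) (g := f)
    fun x hx => by simpa using hf (0, ⟨x, hx⟩)
  rw [hM k (by simpa [cover_syzygy] using hf (1, 0)), LinearMap.zero_comp]

end Contramodule

/-! ### Inverting `s` on the presentation up to homotopy. -/

section Homotopy

variable {R : Type u} [CommRing R] {S : Submonoid R}

/-- The inverse of the action of `s ∈ S` on `S⁻¹R` lifts to the presentation of `S⁻¹R`. -/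
lemma exists_homotopy {s : R} (hs : s ∈ S) [Module.Projective R (Syzygy S)] :
    ∃ (σ₀ : FreeCover S →ₗ[R] FreeCover S) (σ₁ : Syzygy S →ₗ[R] Syzygy S)
      (h : FreeCover S →ₗ[R] Syzygy S), (∀ p, s • σ₀ p = p + h p) ∧
        (∀ p : Syzygy S, s • σ₁ p = p + h p) ∧ ∀ p : Syzygy S, (σ₁ p : FreeCover S) = σ₀ p := by
  let i : Localization S →ₗ[R] Localization S :=
    LinearMap.mulLeft R (IsLocalization.mk' _ 1 ⟨s, hs⟩)
  have hi (x) : s • i x = x := by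
    simp only [i, LinearMap.mulLeft_apply]
    rw [Algebra.smul_def, ← mul_assoc, IsLocalization.mk'_spec' (Localization S) 1 (⟨s, hs⟩ : S),
      map_one, one_mul]
  have he : Function.Exact (Syzygy S).subtype (cover S) := LinearMap.exact_subtype_ker_map _
  obtain ⟨σ₀, hσ₀⟩ := Module.projective_lifting_property (cover S) (i ∘ₗ cover S)
    (cover_surjective S)
  have hσ₀ (p) : cover S (σ₀ p) = i (cover S p) := LinearMap.congr_fun hσ₀ p
  obtain ⟨σ₁, hσ₁⟩ := exists_comp_eq_of_exact (A := Syzygy S) (E := FreeCover S)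
    (D := Localization S) (P := Syzygy S) he (σ₀ ∘ₗ (Syzygy S).subtype) (by
    ext p
    simp [hσ₀])
  have hσ₁ (p) : (σ₁ p : FreeCover S) = σ₀ p := LinearMap.congr_fun hσ₁ p
  -- `σ₀` lifts division by `s`, so `s σ₀ - 1` takes values in `P₁`. It is the homotopy in both
  -- degrees.
  obtain ⟨h, hh⟩ := exists_comp_eq_of_exact (A := Syzygy S) (E := FreeCover S)
    (D := Localization S) he (s • σ₀ - LinearMap.id) (by
    refine LinearMap.ext fun p => ?_
    simp [hσ₀, hi])
  have hh (p) : (h p : FreeCover S) = s • σ₀ p - p := LinearMap.congr_fun hh p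
  refine ⟨σ₀, σ₁, h, fun p => by rw [hh]; abel, fun p => ?_, hσ₁⟩
  ext1
  push_cast
  rw [hσ₁, hh]
  abel

end Homotopy

/-! ### The contramodule `Δ(M) = coker(Hom(P₀, M) → Hom(L, M))`, denoted `X`. -/

section Delta

variable {R : Type u} [CommRing R] {S : Submonoid R}

/-- The map `M → Hom_R(L, M)` for the complex `L = R ⊕ P₁`. -/
noncomputable def constMap (S : Submonoid R) (M : Type u) [AddCommGroup M] [Module R M] :
    M →ₗ[R] (R × Syzygy S →ₗ[R] M) :=
  LinearMap.lcomp R M (LinearMap.fst R R (Syzygy S)) ∘ₗ (LinearMap.ringLmapEquivSelf R R M).symm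

@[simp]
lemma constMap_apply {M : Type u} [AddCommGroup M] [Module R M] (m : M) (x : R × Syzygy S) :
    constMap S M m x = x.1 • m := rfl

variable {M X : Type u} [AddCommGroup M] [Module R M] [AddCommGroup X] [Module R X]
  {q : (R × Syzygy S →ₗ[R] M) →ₗ[R] X} (hq : Function.Surjective q)
  (hE : Function.Exact (LinearMap.lcomp R M (relMap S)) q)

section

variable [Module.Projective R (Syzygy S)]

include hq hE in
/-- The cokernel of `Hom_R(P₀, M) → Hom_R(L, M)` is an `S`-contramodule. -/
theorem isSContramodule_of_exact : isSContramodule S (ModuleCat.of R X) := by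
  have hb := lTensor_bijective_of_torsion (S := S) (L := R × Syzygy S) (P := FreeCover S) (relMap S)
    (fun _ => exists_smul_eq_zero_of_relMap) exists_smul_eq_relMap
  have he : Function.Exact (Syzygy S).subtype (cover S) := LinearMap.exact_subtype_ker_map _
  have hπ := cover_surjective S
  have hi := (Syzygy S).injective_subtype
  refine isSContramodule_iff.2 ⟨(injective_iff_map_eq_zero _).2 fun f hf => ?_, fun g => ?_⟩
  -- That `f` vanishes on `P₁` means that its lift `H` comes there from some `K` with values in
  -- `Hom(P₀, M)`. Gluing gives `G` on `P₀ ⊗ P₀`, so `H` takes values in the image of `Hom(P₀, M)`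
  -- and dies in `X`.
  · obtain ⟨H, rfl⟩ := Module.projective_lifting_property q f hq
    obtain ⟨K, hK⟩ := exists_comp_eq_of_exact (A := FreeCover S →ₗ[R] M)
      (E := R × Syzygy S →ₗ[R] M) (D := X) (P := Syzygy S) hE (H ∘ₗ (Syzygy S).subtype) hf
    obtain ⟨G, hG⟩ := exists_bilinear_eq (P₀ := FreeCover S) (P₁ := Syzygy S)
      (L := R × Syzygy S) (Q := Localization S) hπ he hb hi H K
      fun p x => LinearMap.congr_fun (LinearMap.congr_fun hK p) x
    refine LinearMap.ext fun p => (hE _).2 ⟨G p, ?_⟩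
    exact LinearMap.ext fun x => hG p x
  -- The `K` part of the decomposition of `G` dies in `X`, so `q ∘ H` extends `g` to `P₀`.
  · obtain ⟨G, hG⟩ := Module.projective_lifting_property q g hq
    obtain ⟨H, K, h⟩ := exists_bilinear_add_eq (P₀ := FreeCover S) (P₁ := Syzygy S)
      (L := R × Syzygy S) (Q := Localization S) hπ he hb hi G
    refine ⟨q ∘ₗ H, LinearMap.ext fun p => ?_⟩
    have hp : q (H p) + q (LinearMap.lcomp R M (relMap S) (K p)) = q (G p) := by
      rw [← map_add]
      exact congrArg q (LinearMap.ext fun x => h p x)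
    rw [hE.apply_apply_eq_zero, add_zero] at hp
    exact hp.trans (LinearMap.congr_fun hG p)

end

include hE in
-- The kernel of `M → X` is the image of the evaluation `Hom(S⁻¹R, M) → M` at `1`: such an `f`
-- factors through `S⁻¹R`.
lemma apply_constMap_eq_zero_iff {m : M} : q (constMap S M m) = 0 ↔
    ∃ f : FreeCover S →ₗ[R] M, f (coverOne S) = m ∧ ∀ p : Syzygy S, f p = 0 := by
  refine (hE _).trans ⟨fun ⟨f, hf⟩ => ⟨f, ?_, fun p => ?_⟩, fun ⟨f, hf, h⟩ => ⟨f, ?_⟩⟩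
  · simpa using LinearMap.congr_fun hf (1, 0)
  · simpa using LinearMap.congr_fun hf (0, p)
  · refine LinearMap.ext fun x => ?_
    simp [hf, h]

include hE in
-- The cokernel of `M → X` is `Ext¹(S⁻¹R, M)`, the maps `P₁ → M` modulo those extending to `P₀`.
lemma exists_apply_constMap_eq_iff {φ : R × Syzygy S →ₗ[R] M} : (∃ m, q (constMap S M m) = q φ) ↔
    ∃ f : FreeCover S →ₗ[R] M, ∀ p : Syzygy S, f p = φ (0, p) := by
  constructor
  · rintro ⟨m, hm⟩
    rw [← sub_eq_zero, ← map_sub] at hm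
    obtain ⟨f, hf⟩ := (hE _).1 hm
    exact ⟨-f, fun p => by simpa [neg_eq_iff_eq_neg] using LinearMap.congr_fun hf (0, p)⟩
  · rintro ⟨f, hf⟩
    refine ⟨φ (1, 0) - f (coverOne S), ?_⟩
    rw [← sub_eq_zero, ← map_sub]
    refine (hE _).2 ⟨-f, LinearMap.ext fun ⟨r, p⟩ => ?_⟩
    have : φ (r, p) = r • φ (1, 0) + φ (0, p) := by
      rw [← map_smul, ← map_add]
      simp
    simp [this, hf]
    abel

include hq hE in
/-- For a contramodule `C`, the map from `C` to the cokernel of `Hom_R(P₀, C) → Hom_R(L, C)`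
is bijective. -/
lemma bijective_of_isSContramodule (hM : isSContramodule S (ModuleCat.of R M)) :
    Function.Bijective (q ∘ₗ constMap S M) := by
  have h := isSContramodule_iff.1 hM
  constructor
  · refine (injective_iff_map_eq_zero _).2 fun m hm => ?_
    obtain ⟨f, rfl, hf⟩ := (apply_constMap_eq_zero_iff hE).1 hm
    have : f = 0 := h.1 (LinearMap.ext hf)
    rw [this, LinearMap.zero_apply]
  · intro x
    obtain ⟨φ, rfl⟩ := hq x
    obtain ⟨f, hf⟩ := h.2 (φ ∘ₗ LinearMap.inr R R (Syzygy S))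
    exact (exists_apply_constMap_eq_iff hE).2 ⟨f, fun p => LinearMap.congr_fun hf p⟩

variable [Module.Projective R (Syzygy S)]

include hE in
-- This and the next three lemmas give bijectivity of `s` on the kernel and the cokernel of `M → X`.
-- Only this one needs `M` coadjusted: `s f` vanishes on the image of `relMap`, so it is zero.
lemma eq_zero_of_smul_eq_zero (hM : isCoadjusted S (ModuleCat.of R M)) {s : R} (hs : s ∈ S) {m : M}
    (hm : q (constMap S M m) = 0) (hsm : s • m = 0) : m = 0 := by
  obtain ⟨f, rfl, hf⟩ := (apply_constMap_eq_zero_iff hE).1 hm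
  obtain ⟨σ₀, σ₁, h, h₀, -, -⟩ := exists_homotopy hs
  have : s • f = 0 := lcomp_relMap_injective hM (LinearMap.ext fun x => by simp [hf, smul_comm s, hsm])
  have h' := congrArg f (h₀ (coverOne S))
  rw [map_smul, map_add, hf, add_zero, ← LinearMap.smul_apply, this] at h'
  exact h'.symm

include hE in
lemma exists_smul_eq_of_apply_eq_zero {s : R} (hs : s ∈ S) {m : M}
    (hm : q (constMap S M m) = 0) : ∃ m', q (constMap S M m') = 0 ∧ s • m' = m := by
  obtain ⟨f, rfl, hf⟩ := (apply_constMap_eq_zero_iff hE).1 hm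
  obtain ⟨σ₀, σ₁, h, h₀, -, h₁⟩ := exists_homotopy hs
  refine ⟨f (σ₀ (coverOne S)), (apply_constMap_eq_zero_iff hE).2 ⟨f ∘ₗ σ₀, rfl, fun p => ?_⟩, ?_⟩
  · rw [LinearMap.comp_apply, ← h₁, hf]
  · rw [← map_smul, h₀, map_add, hf, add_zero]

include hq hE in
lemma exists_of_exists_smul {s : R} (hs : s ∈ S) {x : X} (hx : ∃ m, q (constMap S M m) = s • x) :
    ∃ m, q (constMap S M m) = x := by
  obtain ⟨φ, rfl⟩ := hq x
  rw [← map_smul] at hx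
  obtain ⟨f, hf⟩ := (exists_apply_constMap_eq_iff hE).1 hx
  obtain ⟨σ₀, σ₁, h, -, h₀, h₁⟩ := exists_homotopy hs
  -- On `P₁` one has `f = s φ`, so `f σ₀ = s φ σ₁ = φ + φ h`; subtracting `φ h`, which is defined on
  -- all of `P₀`, leaves an extension of `φ`.
  refine (exists_apply_constMap_eq_iff hE).2
    ⟨f ∘ₗ σ₀ - φ ∘ₗ LinearMap.inr R R (Syzygy S) ∘ₗ h, fun p => ?_⟩
  have h₂ := congrArg (fun y => φ (0, y)) (h₀ p)
  have e₁ : φ (0, s • σ₁ p) = s • φ (0, σ₁ p) := by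
    rw [← map_smul φ, Prod.smul_mk, smul_zero]
  have e₂ : φ (0, p + h p) = φ (0, p) + φ (0, h p) := by
    rw [← map_add]
    simp
  simp only [e₁, e₂] at h₂
  have h₃ : f (σ₁ p) = s • φ (0, σ₁ p) := hf (σ₁ p)
  simp only [LinearMap.sub_apply, LinearMap.comp_apply, ← h₁, h₃, h₂, LinearMap.inr_apply]
  abel

include hq hE in
lemma exists_smul_eq_add {s : R} (hs : s ∈ S) (x : X) :
    ∃ x' m, s • x' = x + q (constMap S M m) := by
  obtain ⟨φ, rfl⟩ := hq x
  obtain ⟨σ₀, σ₁, h, -, h₀, h₁⟩ := exists_homotopy hs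
  let g := φ ∘ₗ LinearMap.inr R R (Syzygy S)
  -- On `P₁` one has `s g σ₁ - g = g h`, and `g h` extends to `P₀`, so the difference comes from
  -- `M`.
  obtain ⟨m, hm⟩ := (exists_apply_constMap_eq_iff hE
    (φ := s • (g ∘ₗ σ₁ ∘ₗ LinearMap.snd R R (Syzygy S)) - φ)).2 ⟨g ∘ₗ h, fun p => by
      have h₂ := congrArg g (h₀ p)
      rw [map_smul, map_add] at h₂
      have : φ (0, p) = g p := rfl
      simp [this, h₂]⟩
  refine ⟨q (g ∘ₗ σ₁ ∘ₗ LinearMap.snd R R (Syzygy S)), m, ?_⟩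
  rw [hm, map_sub, map_smul]
  abel

end Delta

section KernelCokernel

open DerivedCategory

variable {R : Type u} [CommRing R] {S : Submonoid R}

lemma function_exact_f {T : ShortComplex (CochainComplex (ModuleCat.{u} R) ℤ)} (hT : T.Exact)
    (n : ℤ) : Function.Exact (T.f.f n) (T.g.f n) :=
  (ShortComplex.ShortExact.moduleCat_exact_iff_function_exact _).1
    (hT.map (HomologicalComplex.eval _ _ n))

lemma isSInvertible_of_exact_of_mono {A M N : ModuleCat.{u} R} {k : A ⟶ M} {f : M ⟶ N}
    (hk : Function.Injective k) (h : Function.Exact k f)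
    (h₁ : ∀ s ∈ S, ∀ m, f m = 0 → s • m = 0 → m = 0)
    (h₂ : ∀ s ∈ S, ∀ m, f m = 0 → ∃ m', f m' = 0 ∧ s • m' = m) : isSInvertible S A := by
  intro s hs
  constructor
  · refine (injective_iff_map_eq_zero (LinearMap.lsmul R A s)).2 fun a ha => ?_
    refine hk ((h₁ s hs _ (h.apply_apply_eq_zero a) ?_).trans (map_zero k.hom).symm)
    exact (map_smul k.hom s a).symm.trans ((congrArg k ha).trans (map_zero k.hom))
  · intro a
    obtain ⟨m, hm, hsm⟩ := h₂ s hs _ (h.apply_apply_eq_zero a)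
    obtain ⟨a', rfl⟩ := (h m).1 hm
    exact ⟨a', hk ((map_smul k.hom s a').trans hsm)⟩

lemma isSInvertible_of_exact_of_epi {M N C : ModuleCat.{u} R} {f : M ⟶ N} {p : N ⟶ C}
    (hp : Function.Surjective p) (h : Function.Exact f p)
    (h₁ : ∀ s ∈ S, ∀ x, (∃ m, f m = s • x) → ∃ m, f m = x)
    (h₂ : ∀ s ∈ S, ∀ x, ∃ x' m, s • x' = x + f m) : isSInvertible S C := by
  intro s hs
  constructor
  · refine (injective_iff_map_eq_zero (LinearMap.lsmul R C s)).2 fun c hc => ?_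
    obtain ⟨x, rfl⟩ := hp c
    exact (h x).2 (h₁ s hs x ((h _).1 ((map_smul p.hom s x).trans hc)))
  · intro c
    obtain ⟨x, rfl⟩ := hp c
    obtain ⟨x', m, hx⟩ := h₂ s hs x
    refine ⟨p x', ?_⟩
    have := congrArg p.hom hx
    rw [map_smul, map_add] at this
    exact this.trans (by rw [h.apply_apply_eq_zero m, add_zero])

variable [HasDerivedCategory.{w} (ModuleCat.{u} R)]

/-- A morphism of complexes whose kernel and cokernel are termwise `S`-invertible has an
`S`-invertible cone. -/
lemma trW_Q_map_of_kernel_cokernel {K L : CochainComplex (ModuleCat.{u} R) ℤ} (f : K ⟶ L)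
    (hk : ∀ n, isSInvertible S ((kernel f).X n))
    (hc : ∀ n, isSInvertible S ((cokernel f).X n)) : (sInvertible S).trW (Q.map f) := by
  have h₁ : (sInvertible S).trW (Q.map (Abelian.coimage.π f)) :=
    trW_Q_map_g _ (shortExact_kernel_coimage f) (sInvertible_Q_obj hk)
  have h₂ : (sInvertible S).trW (Q.map (Abelian.image.ι f)) :=
    trW_Q_map_f _ (shortExact_image_cokernel f) (sInvertible_Q_obj hc)
  rw [← Abelian.coimage_image_factorisation f, Q.map_comp, Q.map_comp]
  exact MorphismProperty.comp_mem _ _ _ h₁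
    ((MorphismProperty.cancel_left_of_respectsIso _ _ _).2 h₂)

end KernelCokernel

/-! ### Contramodule approximations of complexes. -/

section Contramodule

open DerivedCategory

variable {R : Type u} [CommRing R] (S : Submonoid R)

/-- The natural map `M → Hom_R(L, M)` for the complex `L = R ⊕ P₁`. -/
noncomputable def constNat : 𝟭 (ModuleCat.{u} R) ⟶ homFunctor (R × Syzygy S) where
  app M := ModuleCat.ofHom (constMap S M)
  naturality M N f := by
    ext m
    exact LinearMap.ext fun x => (map_smul f.hom x.1 m).symm

/-- The morphism of complexes `Hom_R(P₀, Z) → Hom_R(L, Z)`. -/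
noncomputable abbrev relComplex (Z : CochainComplex (ModuleCat.{u} R) ℤ) :
    ((homFunctor (FreeCover S)).mapHomologicalComplex (.up ℤ)).obj Z ⟶
      ((homFunctor (R × Syzygy S)).mapHomologicalComplex (.up ℤ)).obj Z :=
  (NatTrans.mapHomologicalComplex (homFunctorMap (relMap S)) (.up ℤ)).app Z

/-- The morphism of complexes `Hom_R(P₀, Z) → Hom_R(P₁, Z)`. -/
noncomputable abbrev resComplex (Z : CochainComplex (ModuleCat.{u} R) ℤ) :
    ((homFunctor (FreeCover S)).mapHomologicalComplex (.up ℤ)).obj Z ⟶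
      ((homFunctor (Syzygy S)).mapHomologicalComplex (.up ℤ)).obj Z :=
  (NatTrans.mapHomologicalComplex (homFunctorMap (Syzygy S).subtype) (.up ℤ)).app Z

/-- The morphism of complexes `Z → Hom_R(L, Z)`. -/
noncomputable abbrev constComplex (Z : CochainComplex (ModuleCat.{u} R) ℤ) :
    Z ⟶ ((homFunctor (R × Syzygy S)).mapHomologicalComplex (.up ℤ)).obj Z :=
  (NatTrans.mapHomologicalComplex (constNat S) (.up ℤ)).app Z

variable [HasProjectiveDimensionLE (localizationModule S) 1]

/-- Termwise, the cokernel of `Hom_R(P₀, Z) → Hom_R(L, Z)` consists of contramodules. -/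
lemma exists_contraPart (Z : CochainComplex (ModuleCat.{u} R) ℤ) :
    ∃ (C : CochainComplex (SCtra S) ℤ)
      (q : ((homFunctor (R × Syzygy S)).mapHomologicalComplex (.up ℤ)).obj Z ⟶
        ((isSContramodule S).ι.mapHomologicalComplex (.up ℤ)).obj C)
      (w : relComplex S Z ≫ q = 0), Epi q ∧ (ShortComplex.mk (relComplex S Z) q w).Exact := by
  have hE : (ShortComplex.mk (relComplex S Z) (cokernel.π _) (cokernel.condition _)).Exact :=
    ShortComplex.exact_of_g_is_cokernel _ (cokernelIsCokernel _)
  refine ⟨HomologicalComplex.liftObjectProperty (isSContramodule S) (cokernel (relComplex S Z))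
    fun n => ?_, cokernel.π _, cokernel.condition _,
    (inferInstance : Epi (cokernel.π (relComplex S Z))), hE⟩
  exact isSContramodule_of_exact (q := ((cokernel.π (relComplex S Z)).f n).hom)
    ((ModuleCat.epi_iff_surjective ((cokernel.π (relComplex S Z)).f n)).1 inferInstance)
    (function_exact_f hE n)

variable {S}

omit [HasProjectiveDimensionLE (localizationModule S) 1] in
lemma mono_relComplex {Z : CochainComplex (ModuleCat.{u} R) ℤ}
    (hZ : ∀ n, isCoadjusted S (Z.X n)) : Mono (relComplex S Z) :=
  HomologicalComplex.mono_of_mono_f _ fun n =>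
    (ModuleCat.mono_iff_injective _).2 (lcomp_relMap_injective (hZ n))

section

variable {Z : CochainComplex (ModuleCat.{u} R) ℤ} {C : CochainComplex (SCtra S) ℤ}
  {q : ((homFunctor (R × Syzygy S)).mapHomologicalComplex (.up ℤ)).obj Z ⟶
    ((isSContramodule S).ι.mapHomologicalComplex (.up ℤ)).obj C}
  {w : relComplex S Z ≫ q = 0} [Epi q] (hE : (ShortComplex.mk (relComplex S Z) q w).Exact)

include hE

omit [HasProjectiveDimensionLE (localizationModule S) 1] in
lemma isIso_constComplex_comp (hZ : ∀ n, isSContramodule S (Z.X n)) :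
    IsIso (constComplex S Z ≫ q) := by
  have (n : ℤ) : IsIso ((constComplex S Z ≫ q).f n) := by
    rw [ConcreteCategory.isIso_iff_bijective]
    exact bijective_of_isSContramodule (M := Z.X n) (q := (q.f n).hom)
      ((ModuleCat.epi_iff_surjective (q.f n)).1 inferInstance) (function_exact_f hE n) (hZ n)
  exact HomologicalComplex.Hom.isIso_of_components _

/-- Termwise the kernel and the cokernel are `Hom(S⁻¹R, -)` and `Ext¹(S⁻¹R, -)`, on which `S` acts
bijectively. -/
lemma trW_constComplex_comp [HasDerivedCategory.{w} (ModuleCat.{u} R)]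
    (hZ : ∀ n, isCoadjusted S (Z.X n)) :
    (sInvertible S).trW (Q.map (constComplex S Z ≫ q)) := by
  have hE' (n : ℤ) := function_exact_f hE n
  have hq (n : ℤ) : Function.Surjective (q.f n).hom :=
    (ModuleCat.epi_iff_surjective (q.f n)).1 inferInstance
  let f := constComplex S Z ≫ q
  refine trW_Q_map_of_kernel_cokernel f (fun n => ?_) (fun n => ?_)
  · have hk : (ShortComplex.mk (kernel.ι f) f (kernel.condition f)).Exact :=
      ShortComplex.exact_of_f_is_kernel _ (kernelIsKernel f)
    refine isSInvertible_of_exact_of_mono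
      ((ModuleCat.mono_iff_injective ((kernel.ι f).f n)).1 inferInstance) (function_exact_f hk n)
      (fun s hs m hm hsm => ?_) fun s hs m hm => ?_
    · exact eq_zero_of_smul_eq_zero (q := (q.f n).hom) (hE' n) (hZ n) hs hm hsm
    · exact exists_smul_eq_of_apply_eq_zero (q := (q.f n).hom) (hE' n) hs hm
  · have hk : (ShortComplex.mk f (cokernel.π f) (cokernel.condition f)).Exact :=
      ShortComplex.exact_of_g_is_cokernel _ (cokernelIsCokernel f)
    refine isSInvertible_of_exact_of_epi
      ((ModuleCat.epi_iff_surjective ((cokernel.π f).f n)).1 inferInstance) (function_exact_f hk n)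
      (fun s hs m hm => ?_) fun s hs x => ?_
    · exact exists_of_exists_smul (q := (q.f n).hom) (hq n) (hE' n) hs hm
    · exact exists_smul_eq_add (q := (q.f n).hom) (hq n) (hE' n) hs x

end

variable [HasDerivedCategory.{w} (ModuleCat.{u} R)]

lemma exists_trW_to_contra (hS : HasBoundedTorsion S) [HasDerivedCategory.{w₁} (SCtra S)]
    (star : DerivedSymbol) (X : DStar (ModuleCat.{u} R) star) :
    ∃ (N : DStar (SCtra S) star) (t : X ⟶ (mapDStar (isSContramodule S).ι star).obj N),
      (sInvertible S).trW t.hom := by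
  let e := Q.objObjPreimageIso X.obj
  obtain ⟨Y, s, hs, hY⟩ := exists_quasiIso_isCoadjusted hS (Q.objPreimage X.obj)
  rw [← isIso_Q_map_iff_quasiIso] at hs
  have hY' : star.property _ (Q.obj Y) :=
    ObjectProperty.prop_of_iso _ (e.symm ≪≫ (asIso (Q.map s)).symm) X.property
  obtain ⟨C, q, w, hq, hE⟩ := exists_contraPart S Y
  have := mono_relComplex hY
  have hT : (ShortComplex.mk (relComplex S Y) q w).ShortExact := ⟨hE⟩
  have ht : (sInvertible S).trW (Q.map (constComplex S Y ≫ q)) := trW_constComplex_comp hE hY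
  let eC : (isSContramodule S).ι.mapDerivedCategory.obj (Q.obj C) ≅
      Q.obj (((isSContramodule S).ι.mapHomologicalComplex (.up ℤ)).obj C) :=
    (isSContramodule S).ι.mapDerivedCategoryFactors.app C
  -- `C` is the cone of a map between two exact functors applied to `Y`, so it inherits the
  -- boundedness of `Y`.
  have h : star.property _ ((isSContramodule S).ι.mapDerivedCategory.obj (Q.obj C)) :=
    ObjectProperty.prop_of_iso _ eC.symm
      (prop_Q_obj_X₃ _ hT (property_Q_obj_map star _ hY') (property_Q_obj_map star _ hY'))
  refine ⟨⟨Q.obj C, property_of_property_mapDerivedCategory _ star h⟩,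
    ObjectProperty.homMk ((e.inv ≫ inv (Q.map s)) ≫ Q.map (constComplex S Y ≫ q) ≫ eC.inv), ?_⟩
  exact (MorphismProperty.cancel_left_of_respectsIso (sInvertible S).trW
    (e.inv ≫ inv (Q.map s)) _).2 ((MorphismProperty.cancel_right_of_respectsIso _ _ eC.inv).2 ht)

end Contramodule

section Naturality

variable {A : Type u₁} [Category.{v₁} A] [Abelian A]
  {F G : A ⥤ A} [F.Additive] [G.Additive] {K L : CochainComplex A ℤ}

lemma map_comp_mapHomologicalComplex_app (τ : F ⟶ G) (f : K ⟶ L) :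
    (F.mapHomologicalComplex (.up ℤ)).map f ≫ (NatTrans.mapHomologicalComplex τ (.up ℤ)).app L =
      (NatTrans.mapHomologicalComplex τ (.up ℤ)).app K ≫ (G.mapHomologicalComplex (.up ℤ)).map f :=
  (NatTrans.mapHomologicalComplex τ (.up ℤ)).naturality f

lemma mapHomologicalComplex_app_comp_map (τ : 𝟭 A ⟶ G) (f : K ⟶ L) :
    (show K ⟶ (G.mapHomologicalComplex (.up ℤ)).obj K from
      (NatTrans.mapHomologicalComplex τ (.up ℤ)).app K) ≫
        (G.mapHomologicalComplex (.up ℤ)).map f =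
      f ≫ (show L ⟶ (G.mapHomologicalComplex (.up ℤ)).obj L from
        (NatTrans.mapHomologicalComplex τ (.up ℤ)).app L) := by
  ext1 n
  exact (τ.naturality (f.f n)).symm

lemma map_comp_mapHomologicalComplex_app' (τ : F ⟶ 𝟭 A) (f : K ⟶ L) :
    (F.mapHomologicalComplex (.up ℤ)).map f ≫
      (show (F.mapHomologicalComplex (.up ℤ)).obj L ⟶ L from
        (NatTrans.mapHomologicalComplex τ (.up ℤ)).app L) =
      (show (F.mapHomologicalComplex (.up ℤ)).obj K ⟶ K from
        (NatTrans.mapHomologicalComplex τ (.up ℤ)).app K) ≫ f := by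
  ext1 n
  exact τ.naturality (f.f n)

end Naturality

section Contramodule

open DerivedCategory

variable {R : Type u} [CommRing R] (S : Submonoid R)
  [HasProjectiveDimensionLE (localizationModule S) 1] [HasDerivedCategory.{w} (ModuleCat.{u} R)]

/-- In a roof `M ← Z → N`, replace `Z` by a coadjusted `Y`. Applying `Δ` and `Δ(M) ≅ M`, `Δ(N) ≅ N`
factors both maps through `Y → Δ(Y) = C`, giving a roof of contramodule complexes. -/
lemma full_mapDerivedCategory_contra (hS : HasBoundedTorsion S)
    [HasDerivedCategory.{w₁} (SCtra S)] : (isSContramodule S).ι.mapDerivedCategory.Full := by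
  refine full_mapDerivedCategory_of_right_fac _ fun M N f => ?_
  obtain ⟨Z, s, hs, g, rfl⟩ := right_fac f
  obtain ⟨Y, t, ht, hY⟩ := exists_quasiIso_isCoadjusted hS Z
  rw [← isIso_Q_map_iff_quasiIso] at ht
  obtain ⟨C, q, w, hq, hE⟩ := exists_contraPart S Y
  have key (M : CochainComplex (SCtra S) ℤ)
      (s : Y ⟶ ((isSContramodule S).ι.mapHomologicalComplex (.up ℤ)).obj M) :
      ∃ s' : C ⟶ M, constComplex S Y ≫ q ≫
        ((isSContramodule S).ι.mapHomologicalComplex (.up ℤ)).map s' = s ∧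
        (IsIso (Q.map s) →
          IsIso (Q.map (((isSContramodule S).ι.mapHomologicalComplex (.up ℤ)).map s'))) := by
    obtain ⟨C', q', w', hq', hE'⟩ := exists_contraPart S
      (((isSContramodule S).ι.mapHomologicalComplex (.up ℤ)).obj M)
    have := isIso_constComplex_comp hE' fun n => (M.X n).property
    let e := constComplex S (((isSContramodule S).ι.mapHomologicalComplex (.up ℤ)).obj M) ≫ q'
    have h₁ : relComplex S Y ≫ ((homFunctor (R × Syzygy S)).mapHomologicalComplex (.up ℤ)).map s =
        ((homFunctor (FreeCover S)).mapHomologicalComplex (.up ℤ)).map s ≫ relComplex S _ :=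
      (map_comp_mapHomologicalComplex_app _ s).symm
    have h₂ : constComplex S Y ≫
        ((homFunctor (R × Syzygy S)).mapHomologicalComplex (.up ℤ)).map s =
        s ≫ constComplex S _ :=
      mapHomologicalComplex_app_comp_map _ s
    let k := hE.desc (((homFunctor (R × Syzygy S)).mapHomologicalComplex (.up ℤ)).map s ≫ q')
      (by rw [reassoc_of% h₁, w', comp_zero])
    have hk : q ≫ k = ((homFunctor (R × Syzygy S)).mapHomologicalComplex (.up ℤ)).map s ≫ q' :=
      hE.g_desc _ _
    obtain ⟨s', hs'⟩ := exists_lift_hom (k ≫ inv e)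
    refine ⟨s', ?_, fun hs => ?_⟩
    · have he : constComplex S _ ≫ q' ≫ inv e = 𝟙 _ := by
        rw [← Category.assoc]
        exact IsIso.hom_inv_id e
      rw [hs', reassoc_of% hk, reassoc_of% h₂, he, Category.comp_id]
    · have := mono_relComplex hY
      have := mono_relComplex (S := S)
        (Z := ((isSContramodule S).ι.mapHomologicalComplex (.up ℤ)).obj M)
        fun n => isCoadjusted_of_isSContramodule (M.X n).property
      let φ : ShortComplex.mk (relComplex S Y) q w ⟶ ShortComplex.mk (relComplex S _) q' w' :=
        { τ₁ := ((homFunctor (FreeCover S)).mapHomologicalComplex (.up ℤ)).map s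
          τ₂ := ((homFunctor (R × Syzygy S)).mapHomologicalComplex (.up ℤ)).map s
          τ₃ := k
          comm₁₂ := h₁.symm
          comm₂₃ := hk.symm }
      have hT : (ShortComplex.mk (relComplex S Y) q w).ShortExact := ⟨hE⟩
      have hT' : (ShortComplex.mk (relComplex S _) q' w').ShortExact := ⟨hE'⟩
      -- `k` is `Δ(s)`. Its source and target are cokernels of monomorphisms between values of exact
      -- functors, so it is a quasi-isomorphism whenever `s` is.
      have h : IsIso (Q.map k) := by
        refine isIso₃_of_isIso₁₂ (triangleOfSES.map hT hT' φ) (triangleOfSES_distinguished hT)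
          (triangleOfSES_distinguished hT') ?_ ?_
        all_goals
          rw [isIso_Q_map_iff_quasiIso] at hs
          exact (isIso_Q_map_iff_quasiIso _ _).2 (by infer_instance)
      rw [hs', Q.map_comp]
      infer_instance
  obtain ⟨g', hg', -⟩ := key N (t ≫ g)
  obtain ⟨s', hs', hs''⟩ := key M (t ≫ s)
  have hts : IsIso (Q.map (t ≫ s)) := by
    rw [Q.map_comp]
    infer_instance
  have hs'' := hs'' hts
  refine ⟨C, s', g', hs'', ?_⟩
  -- Followed by the quasi-isomorphism `s'`, this map is the quasi-isomorphism `t ≫ s`; so it is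
  -- invertible and can be cancelled.
  have h : IsIso (Q.map (constComplex S Y ≫ q)) := by
    rw [← hs', ← Category.assoc, Q.map_comp] at hts
    exact IsIso.of_isIso_comp_right _
      (Q.map (((isSContramodule S).ι.mapHomologicalComplex (.up ℤ)).map s'))
  rw [← cancel_epi (Q.map (constComplex S Y ≫ q)), ← Q.map_comp_assoc, ← Q.map_comp,
    Category.assoc, Category.assoc, hs', hg']
  simp

omit [HasProjectiveDimensionLE (localizationModule S) 1]

/-- The evaluation `Hom_R(P₀, M) → M` at the lift of `1 : S⁻¹R`. -/
noncomputable def evalNat : homFunctor (FreeCover S) ⟶ 𝟭 (ModuleCat.{u} R) where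
  app M := ModuleCat.ofHom (LinearMap.applyₗ (coverOne S))

/-- The morphism of complexes `Hom_R(P₀, Z) → Z`. -/
noncomputable abbrev evalComplex (Z : CochainComplex (ModuleCat.{u} R) ℤ) :
    ((homFunctor (FreeCover S)).mapHomologicalComplex (.up ℤ)).obj Z ⟶ Z :=
  (NatTrans.mapHomologicalComplex (evalNat S) (.up ℤ)).app Z

/-- The map `V → Hom_R(P₀, V)` given by the action of `S⁻¹R` on an `S⁻¹R`-module `V`. -/
noncomputable def actionNat : ModuleCat.restrictScalars (algebraMap R (Localization S)) ⟶
    ModuleCat.restrictScalars (algebraMap R (Localization S)) ⋙ homFunctor (FreeCover S) where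
  app V := ModuleCat.ofHom
    (X := (ModuleCat.restrictScalars (algebraMap R (Localization S))).obj V)
    (Y := FreeCover S →ₗ[R] (ModuleCat.restrictScalars (algebraMap R (Localization S))).obj V)
    { toFun (v : V) :=
        { toFun p := cover S p • v
          map_add' p p' := by
            rw [map_add, add_smul]
            rfl
          map_smul' r p := by
            rw [map_smul, Algebra.smul_def, mul_smul]
            rfl }
      map_add' (v v' : V) := LinearMap.ext fun p => smul_add (cover S p) v v'
      map_smul' r (v : V) := LinearMap.ext fun p =>
        smul_comm (cover S p) (algebraMap R (Localization S) r) v }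
  naturality V W f := by
    ext v
    exact LinearMap.ext fun p => (map_smul f.hom (cover S p) v).symm

variable {S} in
-- This expresses `RHom(S⁻¹R, Z) = 0`. It holds termwise for `N` by `isSContramodule_iff`, and
-- passes to `Z` because `Hom(P₀, -)` and `Hom(P₁, -)` are exact.
lemma isIso_Q_map_resComplex (N : CochainComplex (SCtra S) ℤ)
    [HasProjectiveDimensionLE (localizationModule S) 1]
    {Z : CochainComplex (ModuleCat.{u} R) ℤ}
    (s : ((isSContramodule S).ι.mapHomologicalComplex (.up ℤ)).obj N ⟶ Z) [hs : IsIso (Q.map s)] :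
    IsIso (Q.map (resComplex S Z)) := by
  rw [isIso_Q_map_iff_quasiIso] at hs ⊢
  have h : IsIso (resComplex S (((isSContramodule S).ι.mapHomologicalComplex (.up ℤ)).obj N)) := by
    have (n : ℤ) : IsIso ((resComplex S
        (((isSContramodule S).ι.mapHomologicalComplex (.up ℤ)).obj N)).f n) := by
      rw [ConcreteCategory.isIso_iff_bijective]
      exact isSContramodule_iff.1 (N.X n).property
    exact HomologicalComplex.Hom.isIso_of_components _
  have h₁ : ((homFunctor (FreeCover S)).mapHomologicalComplex (.up ℤ)).map s ≫ resComplex S Z =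
      resComplex S _ ≫ ((homFunctor (Syzygy S)).mapHomologicalComplex (.up ℤ)).map s :=
    map_comp_mapHomologicalComplex_app _ s
  refine quasiIso_of_comp_left (φ := ((homFunctor (FreeCover S)).mapHomologicalComplex
    (.up ℤ)).map s) (resComplex S Z) (hφφ' := ?_)
  rw [h₁]
  infer_instance

/-- The source may be taken to be a complex `V'` of `S⁻¹R`-modules, whose action gives a section `η`
of the evaluation `Hom(P₀, V') → V'`. So `g` factors through `Hom(P₀, Z)` by a map that becomes zero
in `Hom(P₁, Z)`, hence is zero in the derived category by `isIso_Q_map_resComplex`. -/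
lemma rightOrthogonal_contra [HasProjectiveDimensionLE (localizationModule S) 1]
    [HasDerivedCategory.{w₁} (SCtra S)] (N : DerivedCategory (SCtra S)) :
    (sInvertible S).rightOrthogonal ((isSContramodule S).ι.mapDerivedCategory.obj N) := by
  intro V f hV
  let eN := Q.objObjPreimageIso N
  let e := (isSContramodule S).ι.mapDerivedCategory.mapIso eN.symm ≪≫
    (isSContramodule S).ι.mapDerivedCategoryFactors.app _
  let eV := Q.objObjPreimageIso V
  let K : CochainComplex (ModuleCat.{u} R) ℤ := Q.objPreimage V
  have hK : IsIso (Q.map (locUnitComplex S K)) := (isIso_Q_map_iff_quasiIso _ _).2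
    (quasiIso_locUnit ((sInvertible S).prop_of_iso eV.symm hV))
  rw [← cancel_mono e.hom, ← cancel_epi (inv (Q.map (locUnitComplex S K)) ≫ eV.hom), zero_comp,
    comp_zero]
  generalize (inv (Q.map (locUnitComplex S K)) ≫ eV.hom) ≫ f ≫ e.hom = f'
  obtain ⟨Z, g, s, hs, rfl⟩ := left_fac f'
  have hd := isIso_Q_map_resComplex _ s
  let V' := ((locFunctor S).mapHomologicalComplex (.up ℤ)).obj K
  let η : V' ⟶ ((homFunctor (FreeCover S)).mapHomologicalComplex (.up ℤ)).obj V' :=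
    (NatTrans.mapHomologicalComplex (Functor.whiskerLeft (ModuleCat.localizedModuleFunctor S)
      (actionNat S)) (.up ℤ)).app K
  have hη : η ≫ evalComplex S V' = 𝟙 V' := by
    ext n v
    change cover S (coverOne S) • (show (K.X n).localizedModule S from v) = v
    rw [cover_coverOne, one_smul]
  have hη' : η ≫ resComplex S V' = 0 := by
    ext n v
    refine LinearMap.ext fun p => ?_
    change cover S p • (show (K.X n).localizedModule S from v) = 0
    rw [cover_syzygy, zero_smul]
  have h₁ : ((homFunctor (FreeCover S)).mapHomologicalComplex (.up ℤ)).map g ≫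
      evalComplex S Z =
        evalComplex S V' ≫ g :=
    map_comp_mapHomologicalComplex_app' _ g
  have h₂ : ((homFunctor (FreeCover S)).mapHomologicalComplex (.up ℤ)).map g ≫ resComplex S Z =
      resComplex S V' ≫ ((homFunctor (Syzygy S)).mapHomologicalComplex (.up ℤ)).map g :=
    map_comp_mapHomologicalComplex_app _ g
  have h₃ : Q.map (η ≫ ((homFunctor (FreeCover S)).mapHomologicalComplex (.up ℤ)).map g) = 0 := by
    rw [← cancel_mono (Q.map (resComplex S Z)), ← Q.map_comp, Category.assoc, h₂,
      reassoc_of% hη', zero_comp, Q.map_zero, zero_comp]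
  have h₄ : g = (η ≫ ((homFunctor (FreeCover S)).mapHomologicalComplex (.up ℤ)).map g) ≫
      evalComplex S Z := by
    rw [Category.assoc, h₁, reassoc_of% hη]
  rw [h₄, Q.map_comp, h₃, zero_comp, zero_comp]

end Contramodule

/-! ### Comparison with `D^⋆(S⁻¹R-mod)`. -/

section EssImage

open DerivedCategory

variable {R : Type u} [CommRing R] (S : Submonoid R) [HasDerivedCategory.{w} (ModuleCat.{u} R)]
  [HasDerivedCategory.{w₁} (ModuleCat.{u} (Localization S))]

/-- The objects of `D^⋆(R-mod)` on which `S` acts invertibly come from `D^⋆(S⁻¹R-mod)`. -/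
lemma essImage_restrictScalars_of_sInvertible (star : DerivedSymbol)
    (X : DStar (ModuleCat.{u} R) star) (hX : sInvertible S X.obj) :
    (mapDStar (ModuleCat.restrictScalars (algebraMap R (Localization S))) star).essImage X := by
  let F := ModuleCat.restrictScalars.{u} (algebraMap R (Localization S))
  let e := Q.objObjPreimageIso X.obj
  let K : CochainComplex (ModuleCat.{u} R) ℤ := Q.objPreimage X.obj
  have hK : IsIso (Q.map (locUnitComplex S K)) := (isIso_Q_map_iff_quasiIso _ _).2
    (quasiIso_locUnit ((sInvertible S).prop_of_iso e.symm hX))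
  let V := ((ModuleCat.localizedModuleFunctor S).mapHomologicalComplex (.up ℤ)).obj K
  let i : F.mapDerivedCategory.obj (Q.obj V) ≅ X.obj :=
    F.mapDerivedCategoryFactors.app V ≪≫ (asIso (Q.map (locUnitComplex S K))).symm ≪≫ e
  have hV : star.property _ (Q.obj V) := property_of_property_mapDerivedCategory F star
    (ObjectProperty.prop_of_iso _ i.symm X.property)
  exact ⟨⟨Q.obj V, hV⟩, ⟨ObjectProperty.isoMk _ i⟩⟩

end EssImage

/-! ### The equivalence. -/

section Main

variable {R : Type u} [CommRing R] (S : Submonoid R)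
  [HasProjectiveDimensionLE (localizationModule S) 1] (hS : HasBoundedTorsion S)
  [HasDerivedCategory.{w₁} (STors S)] [HasDerivedCategory.{w₂} (SCtra S)]
  [HasDerivedCategory.{w₃} (ModuleCat.{u} R)]

include hS in
theorem exists_equivalence_sInvertible (star : DerivedSymbol) :
    ∃ (E : DStar (STors S) star ≌ DStar (SCtra S) star)
      (_ : E.functor.CommShift ℤ) (_ : E.inverse.CommShift ℤ) (_ : E.CommShift ℤ)
      (τ : mapDStar (isSTorsion S).ι star ⟶
        E.functor ⋙ mapDStar (isSContramodule S).ι star),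
      E.IsTriangulated ∧ NatTrans.CommShift τ ℤ ∧
      ∀ M, ((sInvertible S).inverseImage (star.property (ModuleCat.{u} R)).ι).trW (τ.app M) := by
  have := full_mapDerivedCategory_torsion S hS
  have := full_mapDerivedCategory_contra S hS
  have := mapDStar_full (isSTorsion S).ι star
  have := mapDStar_full (isSContramodule S).ι star
  have := mapDStar_faithful (isSTorsion S).ι star
  have := mapDStar_faithful (isSContramodule S).ι star
  refine exists_equivalence_of_complements
    ((sInvertible S).inverseImage (star.property (ModuleCat.{u} R)).ι)
    (mapDStar (isSTorsion S).ι star) (mapDStar (isSContramodule S).ι star)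
    (fun M Z f hZ => ?_) (fun N Z f hZ => ?_) (fun X => ?_) fun X => ?_
  · ext1
    exact leftOrthogonal_torsion S M.obj f.hom hZ
  · ext1
    exact rightOrthogonal_contra S N.obj f.hom hZ
  · obtain ⟨M, t, ht⟩ := exists_trW_from_torsion S hS star X
    exact ⟨M, t, ((sInvertible S).inverseImage_trW_iff _ _).2 ht⟩
  · obtain ⟨N, t, ht⟩ := exists_trW_to_contra hS star X
    exact ⟨N, t, ((sInvertible S).inverseImage_trW_iff _ _).2 ht⟩

end Main

end TriangulatedMatlis

/-- Let `S` be a multiplicative subset of a commutative ring `R` such that `pd_R S⁻¹R ≤ 1` and the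
`S`-torsion in `R` is bounded. For `⋆ = b, +, -, ∅` there are a triangulated equivalence
`E : D^⋆(R-mod_{S-tors}) ≌ D^⋆(R-mod_{S-ctra})` and, in `D^⋆(R-mod)`, a morphism `M ⟶ E(M)`,
natural in `M` and compatible with the shifts, whose cone lies in the essential image of
`D^⋆(S⁻¹R-mod)`. That is, `E` is compatible with the functors from both sides to the Verdier
quotient category `D^⋆(R-mod) / D^⋆(S⁻¹R-mod)`. -/
theorem mainTheorem3 {R : Type u} [CommRing R] (S : Submonoid R)
    [HasProjectiveDimensionLE (TriangulatedMatlis.localizationModule S) 1]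
    (hS : TriangulatedMatlis.HasBoundedTorsion S)
    [HasDerivedCategory.{w₁} (TriangulatedMatlis.STors S)]
    [HasDerivedCategory.{w₂} (TriangulatedMatlis.SCtra S)]
    [HasDerivedCategory.{w₃} (ModuleCat.{u} R)]
    [HasDerivedCategory.{w₄} (ModuleCat.{u} (Localization S))]
    (star : TriangulatedMatlis.DerivedSymbol) :
    ∃ (E : TriangulatedMatlis.DStar (TriangulatedMatlis.STors S) star ≌
          TriangulatedMatlis.DStar (TriangulatedMatlis.SCtra S) star)
      (_ : E.functor.CommShift ℤ) (_ : E.inverse.CommShift ℤ) (_ : E.CommShift ℤ)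
      (τ : TriangulatedMatlis.mapDStar (TriangulatedMatlis.isSTorsion S).ι star ⟶
        E.functor ⋙ TriangulatedMatlis.mapDStar (TriangulatedMatlis.isSContramodule S).ι star),
      E.IsTriangulated ∧ NatTrans.CommShift τ ℤ ∧
      ∀ M : TriangulatedMatlis.DStar (TriangulatedMatlis.STors S) star,
        (TriangulatedMatlis.mapDStar
          (ModuleCat.restrictScalars (algebraMap R (Localization S))) star).essImage.trW
            (τ.app M) := by
  obtain ⟨E, h₁, h₂, h₃, τ, hE, hτ, h⟩ :=
    TriangulatedMatlis.exists_equivalence_sInvertible S hS star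
  exact ⟨E, h₁, h₂, h₃, τ, hE, hτ, fun M => ObjectProperty.trW_monotone
    (fun X hX => TriangulatedMatlis.essImage_restrictScalars_of_sInvertible S star X hX) _ (h M)⟩
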